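/- Let $F$ be a field of characteristic $p>0$ and let $G$ be a group (possibly infinite) such that the group algebra $FG$ is modular, i.e. $G$ contains an element of order $p$. Let $V(FG)$ be the group of normalized units of $FG$ (units of augmentation $1$); for a subgroup $H\le G$ let $\mathfrak I(H)$ be the two-sided ideal of $FG$ generated by all $h-1$, $h\in H$; let $\mathfrak t(G)$ be the set of elements of finite order of $G$, and let $X'$ denote the commutator subgroup of a group $X$. (a) $V(FG)$ is nilpotent if and only if $G$ is nilpotent and $G'$ is a finite $p$-group. (b) Suppose that $V(FG)$ is nilpotent. Then $G$ has a unique Sylow $p$-subgroup $P$ (a Sylow $p$-subgroup being a maximal $p$-subgroup), $\mathfrak t(G)$ is a normal subgroup of $G$, and $\mathfrak t(G)=P\times D$ (internal direct product) for some central subgroup $D$ of $G$. Moreover $1+\mathfrak I(P)\subseteq V(FG)$, it is the unique Sylow $p$-subgroup of $V(FG)$, and $V(FG)'\le 1+\mathfrak I(G')$. If in addition $D$ is finite, then $FD$ is a direct sum of finitely many fields, and if $n$ is the number of summands in such a decomposition, then there is an isomorphism of abelian groups \[ V(FG)/\bigl(1+\mathfrak I(P)\bigr)\;\cong\; V(FD)\times\underbrace{G/\mathfrak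 t(G)\times\cdots\times G/\mathfrak t(G)}_{n}. \] -/

import Mathlib

namespace GroupAlgebraUnits

/-- The augmentation map `FG → F`, sending `∑ a_g g` to `∑ a_g`. -/
noncomputable def augmentation (F G : Type*) [Field F] [Group G] :
    MonoidAlgebra F G →ₐ[F] F :=
  MonoidAlgebra.lift F F G (1 : G →* F)

/-- The group `V(FG)` of normalized units: the units of `FG` of augmentation one. -/
noncomputable def normalizedUnits (F G : Type*) [Field F] [Group G] :
    Subgroup (MonoidAlgebra F G)ˣ :=
  (Units.map (augmentation F G : MonoidAlgebra F G →* F)).ker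

/-- The two-sided ideal `I(H)` of `FG` generated by the elements `h - 1` with `h ∈ H`. -/
noncomputable def relAugIdeal (F : Type*) {G : Type*} [Field F] [Group G] (H : Subgroup G) :
    TwoSidedIdeal (MonoidAlgebra F G) :=
  TwoSidedIdeal.span {x | ∃ h ∈ H, x = MonoidAlgebra.of F G h - 1}

/-- The subgroup of those elements of `V(FG)` which lie in `1 + I(H)`. -/
noncomputable def onePlusIdeal (F : Type*) {G : Type*} [Field F] [Group G] (H : Subgroup G) :
    Subgroup (normalizedUnits F G) where
  carrier := {v | ((v : (MonoidAlgebra F G)ˣ) : MonoidAlgebra F G) - 1 ∈ relAugIdeal F H}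
  one_mem' := by
    simp [(relAugIdeal F H).zero_mem]
  mul_mem' := by
    intro a b ha hb
    change ((a : (MonoidAlgebra F G)ˣ) : MonoidAlgebra F G) *
      ((b : (MonoidAlgebra F G)ˣ) : MonoidAlgebra F G) - 1 ∈ relAugIdeal F H
    have h := (relAugIdeal F H).add_mem ((relAugIdeal F H).mul_mem_left
      ((a : (MonoidAlgebra F G)ˣ) : MonoidAlgebra F G) _ hb) ha
    convert h using 1
    noncomm_ring
  inv_mem' := by
    intro a ha
    change (((a : (MonoidAlgebra F G)ˣ)⁻¹ : (MonoidAlgebra F G)ˣ) : MonoidAlgebra F G) - 1 ∈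
      relAugIdeal F H
    have h := (relAugIdeal F H).neg_mem ((relAugIdeal F H).mul_mem_left
      (((a : (MonoidAlgebra F G)ˣ)⁻¹ : (MonoidAlgebra F G)ˣ) : MonoidAlgebra F G) _ ha)
    convert h using 1
    rw [mul_sub, Units.inv_mul, mul_one, neg_sub]

instance onePlusIdeal_normal (F : Type*) {G : Type*} [Field F] [Group G] (H : Subgroup G) :
    (onePlusIdeal F H).Normal where
  conj_mem := by
    intro n hn g
    have h := (relAugIdeal F H).mul_mem_right _
      (((g : (MonoidAlgebra F G)ˣ)⁻¹ : (MonoidAlgebra F G)ˣ) : MonoidAlgebra F G)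
      ((relAugIdeal F H).mul_mem_left ((g : (MonoidAlgebra F G)ˣ) : MonoidAlgebra F G) _ hn)
    rw [mul_sub, sub_mul, mul_one, Units.mul_inv] at h
    exact h

/-- The torsion part `t(G)`: the set of elements of finite order. -/
def torsionPart (G : Type*) [Group G] : Set G := {g | IsOfFinOrder g}

/-- The normal subgroup generated by `t(G)`. It equals `t(G)` as soon as `t(G)` is a subgroup. -/
def torsionSubgroup (G : Type*) [Group G] : Subgroup G := Subgroup.normalClosure (torsionPart G)

instance torsionSubgroup_normal (G : Type*) [Group G] : (torsionSubgroup G).Normal :=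
  Subgroup.normalClosure_normal

/-- The ring `A` is a direct sum of `n` fields. -/
def IsDirectSumOfFields.{u} (A : Type u) [Ring A] (n : ℕ) : Prop :=
  ∃ (K : Fin n → Type u) (_ : ∀ i, Field (K i)), Nonempty (A ≃+* ((i : Fin n) → K i))

end GroupAlgebraUnits

namespace GroupAlgebraUnits

open MonoidAlgebra
open scoped commutatorElement

/-! ### Quotients and cyclic central subgroups -/

section

variable {G : Type*} [Group G]

/-! Sufficiency in (a). If `G` is nilpotent and `G'` is a finite `p`-group, `FG` is Lie nilpotent,
by induction on `|G'|` (`exists_lieIdeal_eq_bot`): for a central `1 ≠ z ∈ G'`, some Lie ideal dies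
in `F[G/⟨z⟩]`, hence lies in `(z - 1)FG`, and `z - 1` is central and nilpotent. Units congruent to
`1` modulo the Lie ideals form a central series of `V(FG)`.

Necessity in (a). `G` embeds in `V(FG)`, so it is nilpotent and has a central `z` of order `p`. The
sum `ẑ` of the powers of `z` is central with `ẑ² = 0`, and commutation with `a ∈ G` sends `1 + ẑy`
to `1 + ẑ(aya⁻¹ - y)`. Iterating with a single `a` shows that high `p`-powers are central
(`pow_mem_center_of_lowerCentralSeries`). Iterating with elements `a` that climb a chain of
subgroups above the centralizer of `x` modulo `⟨z⟩` keeps the unit nontrivial until the chain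
reaches `G`, which bounds the conjugacy classes (`index_centralizerMod`). B. H. Neumann's theorem
makes the commutator set finite, so `G'` is finite, and Schur's argument makes it a `p`-group.

For (b), take `P` to be the `p`-elements and `D` the central elements of order prime to `p`. The
ideal `I(P)` is nil and `F[G/P]` is commutative and reduced, so `1 + I(P)` is exactly the set of
`p`-elements of `V(FG)`. If `D` is finite it is pure modulo `G'`, so there is a retraction `G → D`
and `G/P ≅ D × T` with `T = G/t(G)` torsion-free abelian. Then `F[G/P] ≅ F[D][T] ≅ ∏ Kᵢ[T]`; each
`Kᵢ[T]` has only the trivial units `r·t`. The scalars `r` assemble to a unit of `FD`, the elements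
`t` give `n` copies of `T`, and units lift modulo the nil ideal (`nonempty_quotient_mulEquiv`). -/

theorem mul_comm_quotient {N : Subgroup G} [N.Normal] (h : commutator G ≤ N) (a b : G ⧸ N) :
    a * b = b * a := by
  obtain ⟨a, rfl⟩ := QuotientGroup.mk_surjective a
  obtain ⟨b, rfl⟩ := QuotientGroup.mk_surjective b
  rw [← QuotientGroup.mk_mul, ← QuotientGroup.mk_mul, QuotientGroup.eq]
  refine h ?_
  rw [show (a * b)⁻¹ * (b * a) = ⁅b⁻¹, a⁻¹⁆ by rw [commutatorElement_def]; group]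
  exact Subgroup.commutator_mem_commutator trivial trivial

theorem normal_zpowers_of_mem_center {z : G} (hz : z ∈ Subgroup.center G) :
    (Subgroup.zpowers z).Normal :=
  ⟨fun x hx g ↦ by
    rwa [Subgroup.mem_center_iff.1 (Subgroup.zpowers_le.2 hz hx) g, mul_inv_cancel_right]⟩

end

/-! ### Relative augmentation ideals -/

section RelAugIdeal

variable (F : Type*) {G H : Type*} [Field F] [Group G] [Group H]

theorem of_sub_one_mem_relAugIdeal {N : Subgroup G} {h : G} (hh : h ∈ N) :
    of F G h - 1 ∈ relAugIdeal F N :=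
  TwoSidedIdeal.subset_span ⟨h, hh, rfl⟩

theorem relAugIdeal_le {N : Subgroup G} {I : TwoSidedIdeal (MonoidAlgebra F G)}
    (h : ∀ g ∈ N, of F G g - 1 ∈ I) : relAugIdeal F N ≤ I := by
  refine TwoSidedIdeal.span_le.2 ?_
  rintro _ ⟨g, hg, rfl⟩
  exact h g hg

theorem relAugIdeal_bot : relAugIdeal F (⊥ : Subgroup G) = ⊥ := by
  refine le_bot_iff.1 (relAugIdeal_le F fun g hg ↦ ?_)
  rw [Subgroup.mem_bot.1 hg, map_one, sub_self]
  exact TwoSidedIdeal.zero_mem _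

/-- Moving each group element to a chosen representative of its fibre costs only multiples of `k -
1` with `k ∈ ker f`. The map `s` has to be a section on the range of `f` only, so `f` need not be
surjective. -/
theorem mapDomain_section_sub_mem (f : G →* H) (s : H → G) (hs : ∀ g, f (s (f g)) = f g)
    (x : MonoidAlgebra F G) : x - mapDomain (s ∘ f) x ∈ relAugIdeal F f.ker := by
  induction x using MonoidAlgebra.induction_linear with
  | zero => simp
  | add x y hx hy =>
    rw [mapDomain_add, add_sub_add_comm]
    exact (relAugIdeal F f.ker).add_mem hx hy
  | single g a =>
    have hk : (s (f g))⁻¹ * g ∈ f.ker := by simp [MonoidHom.mem_ker, hs]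
    have := (relAugIdeal F f.ker).mul_mem_left (single (s (f g)) a) _
      (of_sub_one_mem_relAugIdeal F hk)
    rw [mul_sub, of_apply, single_mul_single, mul_one, mul_one, mul_inv_cancel_left] at this
    simpa using this

theorem mem_relAugIdeal_ker {f : G →* H} {x : MonoidAlgebra F G} :
    x ∈ relAugIdeal F f.ker ↔ mapDomainRingHom F f x = 0 := by
  constructor
  · intro hx
    have : relAugIdeal F f.ker ≤ TwoSidedIdeal.ker (mapDomainRingHom F f) := by
      refine relAugIdeal_le F fun g hg ↦ ?_
      rw [TwoSidedIdeal.mem_ker, map_sub, map_one, of_apply, mapDomainRingHom_apply,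
        mapDomain_single, MonoidHom.mem_ker.1 hg, ← one_def, sub_self]
    exact (TwoSidedIdeal.mem_ker _).1 (this hx)
  · intro hx
    have h1 := mapDomain_section_sub_mem F f (Function.invFun f)
      (fun g ↦ Function.invFun_eq ⟨g, rfl⟩) x
    have h2 : mapDomain (Function.invFun f ∘ f) x =
        mapDomain (Function.invFun f) (mapDomain f x) := by
      ext; simp [mapDomain, Finsupp.mapDomain_comp]
    rw [mapDomainRingHom_apply] at hx
    rwa [h2, hx, mapDomain_zero, sub_zero] at h1

theorem mem_relAugIdeal_iff {N : Subgroup G} [N.Normal] {x : MonoidAlgebra F G} :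
    x ∈ relAugIdeal F N ↔ mapDomainRingHom F (QuotientGroup.mk' N) x = 0 := by
  rw [← mem_relAugIdeal_ker, QuotientGroup.ker_mk']

theorem mapDomainRingHom_surjective {f : G →* H} (hf : Function.Surjective f) :
    Function.Surjective (mapDomainRingHom F f) := by
  intro y
  refine ⟨mapDomain (Function.surjInv hf) y, ?_⟩
  have : f ∘ Function.surjInv hf = id := funext (Function.surjInv_eq hf)
  ext
  simp [mapDomain, ← Finsupp.mapDomain_comp, this]

theorem augmentation_single (g : G) (a : F) : augmentation F G (single g a) = a := by
  simp [augmentation]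

theorem augmentation_of (g : G) : augmentation F G (of F G g) = 1 :=
  augmentation_single F g 1

theorem augmentation_mapDomain (f : G →* H) (x : MonoidAlgebra F G) :
    augmentation F H (mapDomainRingHom F f x) = augmentation F G x := by
  induction x using MonoidAlgebra.induction_linear with
  | zero => simp
  | add x y hx hy => rw [map_add, map_add, hx, hy, map_add]
  | single g a => rw [mapDomainRingHom_apply, mapDomain_single, augmentation_single,
      augmentation_single]

theorem augmentation_eq_zero_of_mem {N : Subgroup G} {x : MonoidAlgebra F G}
    (hx : x ∈ relAugIdeal F N) : augmentation F G x = 0 := by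
  have : relAugIdeal F N ≤ TwoSidedIdeal.ker (augmentation F G) := by
    refine relAugIdeal_le F fun g _ ↦ ?_
    rw [TwoSidedIdeal.mem_ker, map_sub, map_one, augmentation_of, sub_self]
  exact (TwoSidedIdeal.mem_ker _).1 (this hx)

variable {F}

theorem mem_normalizedUnits {u : (MonoidAlgebra F G)ˣ} :
    u ∈ normalizedUnits F G ↔ augmentation F G (u : MonoidAlgebra F G) = 1 := by
  rw [normalizedUnits, MonoidHom.mem_ker, Units.ext_iff]
  rfl

theorem mem_onePlusIdeal {N : Subgroup G} {v : normalizedUnits F G} :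
    v ∈ onePlusIdeal F N ↔
      ((v : (MonoidAlgebra F G)ˣ) : MonoidAlgebra F G) - 1 ∈ relAugIdeal F N :=
  Iff.rfl

variable (F) in
/-- The canonical embedding of `G` into the group of normalized units. -/
noncomputable def ofUnits : G →* normalizedUnits F G :=
  (Units.map (of F G)).comp toUnits.toMonoidHom |>.codRestrict _ fun g ↦
    mem_normalizedUnits.2 (augmentation_of F g)

variable (F) in
theorem ofUnits_injective : Function.Injective (ofUnits F (G := G)) := fun _ _ hgh ↦
  of_injective (congrArg (fun v : normalizedUnits F G ↦
    ((v : (MonoidAlgebra F G)ˣ) : MonoidAlgebra F G)) hgh)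

/-- A nilpotent element of augmentation zero, translated by one, as a normalized unit. -/
noncomputable def onePlus (w : MonoidAlgebra F G) (hw : IsNilpotent w)
    (h0 : augmentation F G w = 0) : normalizedUnits F G :=
  ⟨hw.isUnit_one_add.unit, mem_normalizedUnits.2 (by simp [h0])⟩

@[simp]
theorem coe_onePlus (w : MonoidAlgebra F G) (hw : IsNilpotent w) (h0 : augmentation F G w = 0) :
    ((onePlus w hw h0 : (MonoidAlgebra F G)ˣ) : MonoidAlgebra F G) = 1 + w :=
  rfl

theorem normalizedUnits_ext {u v : normalizedUnits F G}
    (h : ((u : (MonoidAlgebra F G)ˣ) : MonoidAlgebra F G) =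
      ((v : (MonoidAlgebra F G)ˣ) : MonoidAlgebra F G)) : u = v :=
  Subtype.ext (Units.ext h)

/-- If all commutators of group elements lie in `N`, then ring commutators lie in `I(N)`. -/
theorem mul_sub_mul_mem_relAugIdeal {N : Subgroup G} (hN : commutator G ≤ N)
    (x y : MonoidAlgebra F G) : x * y - y * x ∈ relAugIdeal F N := by
  induction x using MonoidAlgebra.induction_linear with
  | zero => simp
  | add x x' hx hx' =>
    convert (relAugIdeal F N).add_mem hx hx' using 1
    noncomm_ring
  | single g a =>
    induction y using MonoidAlgebra.induction_linear with
    | zero => simp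
    | add y y' hy hy' =>
      convert (relAugIdeal F N).add_mem hy hy' using 1
      noncomm_ring
    | single h b =>
      -- On group elements, `gh - hg = (⁅g, h⁆ - 1)hg`.
      have hk : ⁅g, h⁆ ∈ N := hN (Subgroup.commutator_mem_commutator trivial trivial)
      have := (relAugIdeal F N).mul_mem_right _ (single (h * g) (a * b))
        (of_sub_one_mem_relAugIdeal F hk)
      rw [sub_mul, of_apply, single_mul_single, one_mul, one_mul, commutatorElement_def,
        show g * h * g⁻¹ * h⁻¹ * (h * g) = g * h by group] at this
      rw [single_mul_single, single_mul_single, mul_comm b a]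
      exact this

theorem commutator_le_onePlusIdeal {N : Subgroup G} (hN : commutator G ≤ N) :
    commutator (normalizedUnits F G) ≤ onePlusIdeal F N := by
  refine Subgroup.commutator_le.2 fun u _ v _ ↦ ?_
  rw [mem_onePlusIdeal]
  have h := (relAugIdeal F N).mul_mem_right _
    (((v * u)⁻¹ : normalizedUnits F G) : (MonoidAlgebra F G)ˣ).val
    (mul_sub_mul_mem_relAugIdeal hN ((u : (MonoidAlgebra F G)ˣ) : MonoidAlgebra F G)
    ((v : (MonoidAlgebra F G)ˣ) : MonoidAlgebra F G))
  convert h using 1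
  have h1 : ⁅u, v⁆ = u * v * (v * u)⁻¹ := by rw [commutatorElement_def]; group
  have h2 : (((v * u) * (v * u)⁻¹ : normalizedUnits F G) : (MonoidAlgebra F G)ˣ).val = 1 := by
    rw [mul_inv_cancel]; rfl
  rw [h1, sub_mul, ← h2]
  rfl

end RelAugIdeal

/-! ### Nil ideals generated by elements that are central and nilpotent -/

section Nil

variable {R : Type*} [Ring R]

/-- A ring element lying in a two-sided ideal generated by central nilpotent elements is
nilpotent. -/
theorem isNilpotent_of_mem_span_central {S : Set R}
    (hS : ∀ s ∈ S, s ∈ Subring.center R ∧ IsNilpotent s) {x : R}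
    (hx : x ∈ TwoSidedIdeal.span S) : IsNilpotent x := by
  -- Nilpotence of single elements is not stable under sums in a noncommutative ring. Lying in `I •
  -- R` for a nilpotent ideal `I` of the centre is stable under all ideal operations.
  suffices h : ∃ I : Ideal (Subring.center R), IsNilpotent I ∧
      x ∈ I • (⊤ : Submodule (Subring.center R) R) by
    obtain ⟨I, ⟨k, hk⟩, hxI⟩ := h
    refine ⟨k, ?_⟩
    have key : ∀ n, x ^ n ∈ I ^ n • (⊤ : Submodule (Subring.center R) R) := by
      intro n
      induction n with
      | zero => simp
      | succ n ih =>
        have h1 : (I ^ n • (⊤ : Submodule (Subring.center R) R)) *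
            (I • (⊤ : Submodule (Subring.center R) R)) ≤
            I ^ (n + 1) • (⊤ : Submodule (Subring.center R) R) := by
          refine Submodule.mul_le.2 fun a ha b hb ↦ ?_
          induction ha using Submodule.smul_induction_on' with
          | add a _ a' _ h h' => rw [add_mul]; exact add_mem h h'
          | smul r hr a _ =>
            induction hb using Submodule.smul_induction_on' with
            | add a _ a' _ h h' => rw [mul_add]; exact add_mem h h'
            | smul s hs b _ =>
              rw [smul_mul_smul_comm, pow_succ]
              exact Submodule.smul_mem_smul (Ideal.mul_mem_mul hr hs) trivial
        rw [pow_succ x]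
        exact h1 (Submodule.mul_mem_mul ih hxI)
    have := key k
    rw [hk] at this
    simpa using this
  induction hx using TwoSidedIdeal.span_induction with
  | mem x hx =>
    obtain ⟨hc, k, hk⟩ := hS x hx
    refine ⟨Ideal.span {⟨x, hc⟩}, ⟨k, ?_⟩, ?_⟩
    · rw [Ideal.span_singleton_pow, Ideal.zero_eq_bot, Ideal.span_singleton_eq_bot]
      exact Subtype.ext hk
    · have := Submodule.smul_mem_smul (N := (⊤ : Submodule (Subring.center R) R))
        (Ideal.mem_span_singleton_self (⟨x, hc⟩ : Subring.center R)) (Submodule.mem_top (x := 1))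
      simpa [Subring.smul_def] using this
  | zero => exact ⟨⊥, ⟨1, by simp⟩, zero_mem _⟩
  | add x y _ _ ihx ihy =>
    obtain ⟨I, hI, hx⟩ := ihx
    obtain ⟨J, hJ, hy⟩ := ihy
    refine ⟨I + J, (Commute.all I J).isNilpotent_add hI hJ, add_mem ?_ ?_⟩
    · exact Submodule.smul_mono_left (le_sup_left : I ≤ I ⊔ J) hx
    · exact Submodule.smul_mono_left (le_sup_right : J ≤ I ⊔ J) hy
  | neg x _ ih =>
    obtain ⟨I, hI, hx⟩ := ih
    exact ⟨I, hI, neg_mem hx⟩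
  | left_absorb a x _ ih =>
    obtain ⟨I, hI, hx⟩ := ih
    refine ⟨I, hI, ?_⟩
    clear * - hx
    induction hx using Submodule.smul_induction_on' with
    | add a _ a' _ h h' => rw [mul_add]; exact add_mem h h'
    | smul r hr b _ => rw [mul_smul_comm]; exact Submodule.smul_mem_smul hr trivial
  | right_absorb a x _ ih =>
    obtain ⟨I, hI, hx⟩ := ih
    refine ⟨I, hI, ?_⟩
    clear * - hx
    induction hx using Submodule.smul_induction_on' with
    | add a _ a' _ h h' => rw [add_mul]; exact add_mem h h'
    | smul r hr b _ => rw [smul_mul_assoc]; exact Submodule.smul_mem_smul hr trivial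

/-- The preceding statement applied in `R / I`; it allows nilpotence to be proved one layer of a
central series at a time. -/
theorem exists_pow_mem_of_mem_span {I : TwoSidedIdeal R} {S : Set R}
    (hS : ∀ s ∈ S, (∀ r, r * s - s * r ∈ I) ∧ IsNilpotent s) {x : R}
    (hx : x ∈ TwoSidedIdeal.span S) : ∃ k, x ^ k ∈ I := by
  have hker : ∀ y, y ∈ I ↔ I.ringCon.mk' y = 0 := fun y ↦ by
    rw [← TwoSidedIdeal.mem_ker, TwoSidedIdeal.ker_ringCon_mk']
  have hx' : I.ringCon.mk' x ∈ TwoSidedIdeal.span (I.ringCon.mk' '' S) := by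
    have : TwoSidedIdeal.span S ≤
        (TwoSidedIdeal.span (I.ringCon.mk' '' S)).comap I.ringCon.mk' :=
      TwoSidedIdeal.span_le.2 fun s hs ↦ by
        rw [SetLike.mem_coe, TwoSidedIdeal.mem_comap]
        exact TwoSidedIdeal.subset_span ⟨s, hs, rfl⟩
    exact (TwoSidedIdeal.mem_comap _).1 (this hx)
  obtain ⟨k, hk⟩ := isNilpotent_of_mem_span_central (by
    rintro _ ⟨s, hs, rfl⟩
    refine ⟨Subring.mem_center_iff.2 fun r ↦ ?_, (hS s hs).2.map _⟩
    obtain ⟨r, rfl⟩ := I.ringCon.mk'_surjective r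
    rw [← sub_eq_zero, ← map_mul, ← map_mul, ← map_sub, ← hker]
    exact (hS s hs).1 r) hx'
  exact ⟨k, (hker _).2 (by rw [map_pow, hk])⟩

end Nil

section NilGroup

variable {F G : Type*} [Field F] [Group G] {p : ℕ} [Fact p.Prime] [CharP F p]

instance charP_monoidAlgebra : CharP (MonoidAlgebra F G) p :=
  charP_of_injective_algebraMap (algebraMap F (MonoidAlgebra F G)).injective p

variable (F) in
theorem isNilpotent_of_sub_one {g : G} (hg : ∃ k, g ^ p ^ k = 1) : IsNilpotent (of F G g - 1) := by
  obtain ⟨k, hk⟩ := hg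
  refine ⟨p ^ k, ?_⟩
  rw [sub_pow_char_pow_of_commute _ _ (Commute.one_right _), ← map_pow, hk, map_one, one_pow,
    sub_self]

/-- In a nilpotent group, a normal `p`-subgroup generates a nil ideal in characteristic `p`. -/
theorem isNilpotent_of_mem_relAugIdeal [Group.IsNilpotent G] {P : Subgroup G} [P.Normal]
    (hP : IsPGroup p P) {x : MonoidAlgebra F G} (hx : x ∈ relAugIdeal F P) : IsNilpotent x := by
  obtain ⟨n, hn⟩ := Group.IsNilpotent.nilpotent G
  -- Climb the upper central series: for `h` in layer `i + 1`, `h - 1` is central modulo the ideal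
  -- of layer `i`, since `⁅g, h⁆` lies in layer `i`.
  have key : ∀ i, ∀ x ∈ relAugIdeal F (P ⊓ Subgroup.upperCentralSeries G i), IsNilpotent x := by
    intro i
    induction i with
    | zero =>
      intro x hx
      rw [Subgroup.upperCentralSeries_zero, inf_bot_eq, relAugIdeal_bot,
        TwoSidedIdeal.mem_bot] at hx
      rw [hx]
      exact IsNilpotent.zero
    | succ i ih =>
      intro x hx
      obtain ⟨k, hk⟩ := exists_pow_mem_of_mem_span
        (I := relAugIdeal F (P ⊓ Subgroup.upperCentralSeries G i)) (by
        rintro _ ⟨h, hh, rfl⟩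
        constructor
        · intro r
          induction r using MonoidAlgebra.induction_linear with
          | zero => simp
          | add a b ha hb =>
            convert TwoSidedIdeal.add_mem _ ha hb using 1
            noncomm_ring
          | single g a =>
            have hk : ⁅g, h⁆ ∈ P ⊓ Subgroup.upperCentralSeries G i := by
              refine Subgroup.mem_inf.2 ⟨?_, ?_⟩
              · exact mul_mem (‹P.Normal›.conj_mem h hh.1 g) (inv_mem hh.1)
              · rw [← inv_mem_iff, commutatorElement_inv]
                exact Subgroup.mem_upperCentralSeries_succ_iff.1 hh.2 g
            have := (relAugIdeal F (P ⊓ Subgroup.upperCentralSeries G i)).mul_mem_right _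
              (single (h * g) a) (of_sub_one_mem_relAugIdeal F hk)
            rw [sub_mul, of_apply, single_mul_single, one_mul, one_mul, commutatorElement_def,
              show g * h * g⁻¹ * h⁻¹ * (h * g) = g * h by group] at this
            rw [mul_sub, sub_mul, mul_one, one_mul, of_apply, single_mul_single,
              single_mul_single, mul_one, one_mul]
            convert this using 1
            abel
        · refine isNilpotent_of_sub_one (p := p) F ?_
          obtain ⟨k, hk⟩ := hP ⟨h, hh.1⟩
          exact ⟨k, congrArg Subtype.val hk⟩) hx
      obtain ⟨m, hm⟩ := ih _ hk
      exact ⟨k * m, by rw [pow_mul, hm]⟩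
  refine key n x ?_
  rwa [hn, inf_top_eq]

end NilGroup

/-! ### Lie nilpotence of group algebras -/

section Lie

/-- The lower Lie series of two-sided ideals of a ring: each term is generated by the additive
commutators of ring elements with elements of the previous one. -/
def lieIdeal (R : Type*) [Ring R] : ℕ → TwoSidedIdeal R
  | 0 => ⊤
  | n + 1 => TwoSidedIdeal.span {x | ∃ r, ∃ s ∈ lieIdeal R n, x = r * s - s * r}

variable {R S : Type*} [Ring R] [Ring S]

theorem mul_sub_mul_mem_lieIdeal {n : ℕ} (r : R) {s : R} (hs : s ∈ lieIdeal R n) :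
    r * s - s * r ∈ lieIdeal R (n + 1) :=
  TwoSidedIdeal.subset_span ⟨r, s, hs, rfl⟩

theorem map_mem_lieIdeal (f : R →+* S) {n : ℕ} {x : R} (hx : x ∈ lieIdeal R n) :
    f x ∈ lieIdeal S n := by
  induction n generalizing x with
  | zero => exact TwoSidedIdeal.mem_top S
  | succ n ih =>
    have : lieIdeal R (n + 1) ≤ (lieIdeal S (n + 1)).comap f := by
      refine TwoSidedIdeal.span_le.2 ?_
      rintro _ ⟨r, s, hs, rfl⟩
      rw [SetLike.mem_coe, TwoSidedIdeal.mem_comap, map_sub, map_mul, map_mul]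
      exact mul_sub_mul_mem_lieIdeal _ (ih hs)
    exact (TwoSidedIdeal.mem_comap _).1 (this hx)

/-- The two-sided ideal of multiples `c * y` of a central element `c`, with `y` in a given
two-sided ideal. -/
def centralMulIdeal {c : R} (hc : ∀ r, r * c = c * r) (I : TwoSidedIdeal R) : TwoSidedIdeal R :=
  .mk' {x | ∃ y ∈ I, x = c * y}
    ⟨0, I.zero_mem, (mul_zero c).symm⟩
    (by rintro _ _ ⟨x, hx, rfl⟩ ⟨y, hy, rfl⟩; exact ⟨x + y, I.add_mem hx hy, (mul_add _ _ _).symm⟩)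
    (by rintro _ ⟨x, hx, rfl⟩; exact ⟨-x, I.neg_mem hx, (mul_neg _ _).symm⟩)
    (by rintro r _ ⟨x, hx, rfl⟩
        exact ⟨r * x, I.mul_mem_left _ _ hx, by rw [← mul_assoc, hc, mul_assoc]⟩)
    (by rintro _ r ⟨x, hx, rfl⟩; exact ⟨x * r, I.mul_mem_right _ _ hx, mul_assoc _ _ _⟩)

theorem mem_centralMulIdeal {c : R} (hc : ∀ r, r * c = c * r) {I : TwoSidedIdeal R} {x : R} :
    x ∈ centralMulIdeal hc I ↔ ∃ y ∈ I, x = c * y := by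
  rw [centralMulIdeal, TwoSidedIdeal.mem_mk']
  rfl

/-- Since `c` is central, `[r, cy] = c[r, y]`: once the series has acquired a factor `c`, it starts
afresh on the cofactor. Every `m` steps thus contribute another `c`. -/
theorem lieIdeal_add_le {c : R} (hc : ∀ r, r * c = c * r) {m : ℕ}
    (hm : lieIdeal R m ≤ centralMulIdeal hc ⊤) (j : ℕ) :
    lieIdeal R (m + j) ≤ centralMulIdeal hc (lieIdeal R j) := by
  induction j with
  | zero => exact hm
  | succ j ih =>
    refine TwoSidedIdeal.span_le.2 ?_
    rintro _ ⟨r, s, hs, rfl⟩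
    obtain ⟨y, hy, rfl⟩ := (mem_centralMulIdeal hc).1 (ih hs)
    refine (mem_centralMulIdeal hc).2 ⟨_, mul_sub_mul_mem_lieIdeal r hy, ?_⟩
    rw [← mul_assoc, hc, mul_assoc, mul_assoc, mul_sub]

theorem lieIdeal_eq_bot_of_isNilpotent {c : R} (hc : ∀ r, r * c = c * r) (hn : IsNilpotent c)
    {m : ℕ} (hm : lieIdeal R m ≤ centralMulIdeal hc ⊤) : ∃ n, lieIdeal R n = ⊥ := by
  obtain ⟨k, hk⟩ := hn
  have key : ∀ q, ∀ x ∈ lieIdeal R (q * m), ∃ y, x = c ^ q * y := by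
    intro q
    induction q with
    | zero => exact fun x _ ↦ ⟨x, by simp⟩
    | succ q ih =>
      intro x hx
      rw [Nat.succ_mul, add_comm] at hx
      obtain ⟨y, hy, rfl⟩ := (mem_centralMulIdeal hc).1 (lieIdeal_add_le hc hm _ hx)
      obtain ⟨w, rfl⟩ := ih y hy
      exact ⟨w, by rw [pow_succ', mul_assoc]⟩
  refine ⟨k * m, le_bot_iff.1 fun x hx ↦ ?_⟩
  obtain ⟨y, rfl⟩ := key k x hx
  rw [hk, zero_mul]
  exact TwoSidedIdeal.zero_mem _

end Lie

section

variable (F : Type*) {G : Type*} [Field F] [Group G]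

-- The elements `g` with `g - 1 ∈ I` form a subgroup.
theorem relAugIdeal_zpowers_le {z : G} {I : TwoSidedIdeal (MonoidAlgebra F G)}
    (hz : of F G z - 1 ∈ I) : relAugIdeal F (Subgroup.zpowers z) ≤ I := by
  let K : Subgroup G :=
    { carrier := {g | of F G g - 1 ∈ I}
      one_mem' := by
        change of F G 1 - 1 ∈ I
        rw [map_one, sub_self]
        exact I.zero_mem
      mul_mem' := fun {a b} ha hb ↦ by
        have := I.add_mem (I.mul_mem_left (of F G a) _ hb) ha
        rw [mul_sub, mul_one, sub_add_sub_cancel, ← map_mul] at this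
        exact this
      inv_mem' := fun {a} ha ↦ by
        have := I.neg_mem (I.mul_mem_left (of F G a⁻¹) _ ha)
        rw [mul_sub, mul_one, neg_sub, ← map_mul, inv_mul_cancel, map_one] at this
        exact this }
  have hK : Subgroup.zpowers z ≤ K := by
    rw [Subgroup.zpowers_le]
    exact hz
  exact relAugIdeal_le F fun g hg ↦ hK hg

theorem of_sub_one_comm {z : G} (hz : z ∈ Subgroup.center G) (r : MonoidAlgebra F G) :
    r * (of F G z - 1) = (of F G z - 1) * r := by
  rw [mul_sub, sub_mul, mul_one, one_mul,
    (of_commute (fun g ↦ (Subgroup.mem_center_iff.1 hz g).symm) r).eq]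

end

theorem exists_mem_center_inf_commutator {G : Type*} [Group G] [Group.IsNilpotent G]
    (h : commutator G ≠ ⊥) : ∃ z ∈ commutator G, z ∈ Subgroup.center G ∧ z ≠ 1 := by
  classical
  have hex := Subgroup.nilpotent_iff_lowerCentralSeries.1 ‹Group.IsNilpotent G›
  set n := Nat.find hex with hn
  have hbot := Nat.find_spec hex
  have h1 : 1 < n := by
    rw [hn, Nat.lt_find_iff]
    intro m hm hm'
    refine h (le_bot_iff.1 ?_)
    rw [← Subgroup.top_lowerCentralSeries_one, ← hm']
    exact Subgroup.lowerCentralSeries_antitone _ hm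
  have h2 := Nat.find_min hex (show n - 1 < Nat.find hex by omega)
  -- The last nontrivial term of the lower central series is central, and it lies in the commutator
  -- subgroup because `1 ≤ n - 1`.
  obtain ⟨z, hz, hz1⟩ := (Subgroup.bot_or_exists_ne_one _).resolve_left h2
  refine ⟨z, ?_, ?_, hz1⟩
  · rw [← Subgroup.top_lowerCentralSeries_one]
    exact Subgroup.lowerCentralSeries_antitone _ (show 1 ≤ n - 1 by omega) hz
  · refine Subgroup.mem_center_iff.2 fun g ↦ ?_
    have := Subgroup.commutator_mem_commutator hz (Subgroup.mem_top g)
    rw [← Subgroup.lowerCentralSeries_succ, show n - 1 + 1 = n by omega, hn, hbot,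
      Subgroup.mem_bot, commutatorElement_eq_one_iff_mul_comm] at this
    exact this.symm

/-- The group algebra in characteristic `p` of a nilpotent group whose commutator subgroup is a
finite `p`-group is Lie nilpotent. -/
theorem exists_lieIdeal_eq_bot (F : Type*) [Field F] (p : ℕ) [Fact p.Prime] [CharP F p] (c : ℕ) :
    ∀ (G : Type*) [Group G] [Group.IsNilpotent G] [Finite (commutator G)],
      IsPGroup p (commutator G) → Nat.card (commutator G) = c →
      ∃ n, lieIdeal (MonoidAlgebra F G) n = ⊥ := by
  induction c using Nat.strong_induction_on with
  | _ c ih =>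
  intro G _ _ _ hp hc
  by_cases h : commutator G = ⊥
  · refine ⟨1, le_bot_iff.1 (TwoSidedIdeal.span_le.2 ?_)⟩
    rintro _ ⟨r, s, -, rfl⟩
    rw [← relAugIdeal_bot]
    exact mul_sub_mul_mem_relAugIdeal h.le r s
  obtain ⟨z, hz, hzc, hz1⟩ := exists_mem_center_inf_commutator h
  have := normal_zpowers_of_mem_center hzc
  let f := QuotientGroup.mk' (Subgroup.zpowers z)
  have hmap : commutator (G ⧸ Subgroup.zpowers z) = (commutator G).map f := by
    rw [commutator_def, commutator_def, Subgroup.map_commutator,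
      Subgroup.map_top_of_surjective f (QuotientGroup.mk'_surjective _)]
  have hsurj := f.subgroupMap_surjective (commutator G)
  have : Finite ((commutator G).map f) := Finite.of_surjective _ hsurj
  have : Finite (commutator (G ⧸ Subgroup.zpowers z)) := by rwa [hmap]
  -- The quotient map kills `z ≠ 1`, so it is not injective on the commutator subgroup.
  have hcard : Nat.card ((commutator G).map f) < c := by
    by_contra! hle
    have hinj := (hsurj.bijective_of_nat_card_le (hc.trans_le hle)).1
    have : f.subgroupMap (commutator G) ⟨z, hz⟩ = 1 := Subtype.ext
      ((QuotientGroup.eq_one_iff z).2 (Subgroup.mem_zpowers z))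
    exact hz1 (congrArg Subtype.val (hinj (this.trans (map_one _).symm)))
  obtain ⟨m, hm⟩ := ih _ hcard (G ⧸ Subgroup.zpowers z)
    (by rw [hmap]; exact hp.map f) (by rw [hmap])
  have hcomm := of_sub_one_comm F hzc
  refine lieIdeal_eq_bot_of_isNilpotent hcomm (isNilpotent_of_sub_one (p := p) F ?_) (m := m)
    fun x hx ↦ ?_
  · obtain ⟨k, hk⟩ := hp ⟨z, hz⟩
    exact ⟨k, congrArg Subtype.val hk⟩
  · have h1 := map_mem_lieIdeal (mapDomainRingHom F f) hx
    rw [hm, TwoSidedIdeal.mem_bot, ← mem_relAugIdeal_iff] at h1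
    exact relAugIdeal_zpowers_le F ((mem_centralMulIdeal hcomm).2
      ⟨1, TwoSidedIdeal.mem_top _, (mul_one _).symm⟩) h1

/-! ### From Lie nilpotence to nilpotence of the unit group -/

section

variable {F G : Type*} [Field F] [Group G]

/-- The normalized units congruent to one modulo a two-sided ideal. -/
noncomputable def congruenceUnits (I : TwoSidedIdeal (MonoidAlgebra F G)) :
    Subgroup (normalizedUnits F G) where
  carrier := {v | ((v : (MonoidAlgebra F G)ˣ) : MonoidAlgebra F G) - 1 ∈ I}
  one_mem' := by simp
  mul_mem' := by
    intro a b ha hb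
    have h := I.add_mem (I.mul_mem_left ((a : (MonoidAlgebra F G)ˣ) : MonoidAlgebra F G) _ hb) ha
    rw [mul_sub, mul_one, sub_add_sub_cancel] at h
    exact h
  inv_mem' := by
    intro a ha
    have h := I.neg_mem (I.mul_mem_left
      (((a : (MonoidAlgebra F G)ˣ)⁻¹ : (MonoidAlgebra F G)ˣ) : MonoidAlgebra F G) _ ha)
    rw [mul_sub, Units.inv_mul, mul_one, neg_sub] at h
    exact h

theorem mem_congruenceUnits {I : TwoSidedIdeal (MonoidAlgebra F G)} {v : normalizedUnits F G} :
    v ∈ congruenceUnits I ↔ ((v : (MonoidAlgebra F G)ˣ) : MonoidAlgebra F G) - 1 ∈ I :=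
  Iff.rfl

theorem isNilpotent_normalizedUnits_of_lieIdeal {n : ℕ}
    (hn : lieIdeal (MonoidAlgebra F G) n = ⊥) : Group.IsNilpotent (normalizedUnits F G) := by
  refine (Subgroup.nilpotent_iff_finite_descending_central_series _).2
    ⟨n, fun i ↦ congruenceUnits (lieIdeal _ i), ⟨?_, ?_⟩, ?_⟩
  · exact eq_top_iff.2 fun v _ ↦ mem_congruenceUnits.2 (TwoSidedIdeal.mem_top _)
  · intro x i hx g
    have h := (lieIdeal (MonoidAlgebra F G) (i + 1)).neg_mem
      ((lieIdeal (MonoidAlgebra F G) (i + 1)).mul_mem_right _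
      (((g * x)⁻¹ : normalizedUnits F G) : (MonoidAlgebra F G)ˣ).val
      (mul_sub_mul_mem_lieIdeal ((g : (MonoidAlgebra F G)ˣ) : MonoidAlgebra F G) hx))
    -- Hence `⁅x, g⁆ - 1 = (xg - gx)(gx)⁻¹`, and `xg - gx` is unchanged when `x` is replaced by `x -
    -- 1`.
    have h1 : ⁅x, g⁆ = x * g * (g * x)⁻¹ := by rw [commutatorElement_def]; group
    have h2 : (((g * x) * (g * x)⁻¹ : normalizedUnits F G) : (MonoidAlgebra F G)ˣ).val = 1 := by
      rw [mul_inv_cancel]; rfl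
    rw [mem_congruenceUnits, h1, ← h2]
    convert h using 1
    simp only [Subgroup.coe_mul, Units.val_mul]
    noncomm_ring
  · refine le_bot_iff.1 fun v hv ↦ ?_
    have hv' : ((v : (MonoidAlgebra F G)ˣ) : MonoidAlgebra F G) - 1 ∈ lieIdeal _ n := hv
    rw [hn, TwoSidedIdeal.mem_bot, sub_eq_zero] at hv'
    exact normalizedUnits_ext hv'

end

/-! ### Nilpotent groups with central `p`-powers -/

section GroupTheory

/-- In a nilpotent group, torsion of prime order already occurs in the centre. -/
theorem eq_one_of_pow_eq_one_of_center (p : ℕ) (G : Type*) [Group G] [Group.IsNilpotent G] :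
    (∀ z ∈ Subgroup.center G, z ^ p = 1 → z = 1) → ∀ g : G, g ^ p = 1 → g = 1 := by
  refine Group.nilpotent_center_quotient_ind (P := fun G _ _ ↦
    (∀ z ∈ Subgroup.center G, z ^ p = 1 → z = 1) → ∀ g : G, g ^ p = 1 → g = 1) G ?_ ?_
  · intro G _ _ _ g _
    exact Subsingleton.elim _ _
  · intro G _ _ ih h g hg
    have hz : g ∈ Subgroup.center G := by
      refine (QuotientGroup.eq_one_iff g).1 (ih ?_ (g : G ⧸ Subgroup.center G) ?_)
      · intro a ha hap
        obtain ⟨a, rfl⟩ := QuotientGroup.mk_surjective a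
        refine (QuotientGroup.eq_one_iff a).2 (Subgroup.mem_center_iff.2 fun x ↦ ?_)
        have hap' : a ^ p ∈ Subgroup.center G := (QuotientGroup.eq_one_iff _).1 hap
        -- As this commutator is central, its `p`-th power is `⁅x, a ^ p⁆ = 1`, so the hypothesis on
        -- the centre makes it trivial.
        have hx : x * a * x⁻¹ * a⁻¹ ∈ Subgroup.center G := by
          rw [← QuotientGroup.eq_one_iff]
          have := Subgroup.mem_center_iff.1 ha (x : G ⧸ Subgroup.center G)
          rw [QuotientGroup.mk_mul, QuotientGroup.mk_mul, QuotientGroup.mk_mul,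
            QuotientGroup.mk_inv, QuotientGroup.mk_inv, this]
          group
        have h1 : x * a * x⁻¹ = (x * a * x⁻¹ * a⁻¹) * a := by group
        have h2 : (x * a * x⁻¹) ^ p = (x * a * x⁻¹ * a⁻¹) ^ p * a ^ p := by
          rw [h1, Commute.mul_pow (Subgroup.mem_center_iff.1 hx a).symm]
          group
        rw [conj_pow, Subgroup.mem_center_iff.1 hap' x, mul_inv_cancel_right,
          right_eq_mul] at h2
        have := h _ hx h2
        rw [mul_inv_eq_one, mul_inv_eq_iff_eq_mul] at this
        exact this
      · rw [← QuotientGroup.mk_pow, hg, QuotientGroup.mk_one]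
    exact h g hz hg

theorem exists_mem_center_orderOf_eq {G : Type*} [Group G] [Group.IsNilpotent G] {p : ℕ}
    [Fact p.Prime] (hG : ∃ g : G, orderOf g = p) : ∃ z ∈ Subgroup.center G, orderOf z = p := by
  by_contra! hno
  obtain ⟨g, hg⟩ := hG
  have := eq_one_of_pow_eq_one_of_center p G (fun z hz hzp ↦ by
    by_contra hne
    exact hno z hz (orderOf_eq_prime hzp hne)) g (hg ▸ pow_orderOf_eq_one g)
  rw [this, orderOf_one] at hg
  exact (Fact.out : p.Prime).one_lt.ne hg

theorem finiteIndex_centralizer {G : Type*} [Group G] {x : G}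
    (hx : (Set.range fun g ↦ g * x * g⁻¹).Finite) : (Subgroup.centralizer {x}).FiniteIndex := by
  have : Finite (Set.range fun g ↦ g * x * g⁻¹) := hx
  have : Finite (G ⧸ Subgroup.centralizer {x}) := by
    refine Finite.of_injective (β := Set.range fun g ↦ g * x * g⁻¹)
      (fun q ↦ ⟨q.out * x * q.out⁻¹, q.out, rfl⟩) fun q r h ↦ ?_
    have h' : q.out * x * q.out⁻¹ = r.out * x * r.out⁻¹ := congrArg Subtype.val h
    rw [← q.out_eq', ← r.out_eq', QuotientGroup.eq, Subgroup.mem_centralizer_singleton_iff]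
    calc q.out⁻¹ * r.out * x = q.out⁻¹ * (r.out * x * r.out⁻¹) * r.out := by group
      _ = x * (q.out⁻¹ * r.out) := by rw [← h']; group
  exact Subgroup.finiteIndex_of_finite_quotient

/-- B. H. Neumann's theorem, in terms of commutators: a group with conjugacy classes of bounded
size has only finitely many commutators. -/
theorem finite_commutatorSet_of_bounded_conj {G : Type*} [Group G] (m : ℕ)
    (hfin : ∀ x : G, (Set.range fun g ↦ g * x * g⁻¹).Finite)
    (hm : ∀ x : G, (Set.range fun g ↦ g * x * g⁻¹).ncard ≤ m) : Finite (commutatorSet G) := by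
  -- Choose `a` with a largest conjugacy class `A`; `C` below centralizes a set of elements
  -- conjugating `a` to each member of `A`.
  obtain ⟨a, ha⟩ : ∃ a : G, ∀ x : G, (Set.range fun g ↦ g * x * g⁻¹).ncard ≤
      (Set.range fun g ↦ g * a * g⁻¹).ncard := by
    have hbdd : BddAbove (Set.range fun x : G ↦ (Set.range fun g ↦ g * x * g⁻¹).ncard) :=
      ⟨m, by rintro _ ⟨x, rfl⟩; exact hm x⟩
    obtain ⟨a, ha⟩ := Nat.sSup_mem (Set.range_nonempty _) hbdd
    exact ⟨a, fun x ↦ (le_csSup hbdd ⟨x, rfl⟩).trans_eq ha.symm⟩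
  set A : Set G := Set.range fun g ↦ g * a * g⁻¹ with hA
  have hAfin : A.Finite := hfin a
  have : Finite A := hAfin
  choose b hb using fun c : A ↦ c.2
  let C : Subgroup G := ⨅ c : A, Subgroup.centralizer {b c}
  have : ∀ c : A, (Subgroup.centralizer {b c}).FiniteIndex :=
    fun c ↦ finiteIndex_centralizer (hfin _)
  have hC : C.FiniteIndex := Subgroup.finiteIndex_iInf this
  let Φ : Set G := Set.image2 (fun u v ↦ u * v⁻¹) A A
  have hΦ : Φ.Finite := hAfin.image2 _ hAfin
  have key : ∀ h ∈ C, ∀ g, ⁅h, g⁆ ∈ Φ := by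
    intro h hh g
    have hh' := inv_mem hh
    -- For `h ∈ C` the chosen conjugators fix `h⁻¹`, so the class of `h⁻¹a` contains `h⁻¹A`. By
    -- maximality they coincide, and `g(h⁻¹a)g⁻¹ = h⁻¹c` rearranges to `⁅h, g⁆ = c(gag⁻¹)⁻¹`.
    have hsub : (fun c ↦ h⁻¹ * c) '' A ⊆ Set.range fun g ↦ g * (h⁻¹ * a) * g⁻¹ := by
      rintro _ ⟨c, hc, rfl⟩
      refine ⟨b ⟨c, hc⟩, ?_⟩
      have h1 := Subgroup.mem_centralizer_singleton_iff.1 ((Subgroup.mem_iInf.1 hh') ⟨c, hc⟩)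
      have h2 : b ⟨c, hc⟩ * a * (b ⟨c, hc⟩)⁻¹ = c := hb ⟨c, hc⟩
      change b ⟨c, hc⟩ * (h⁻¹ * a) * (b ⟨c, hc⟩)⁻¹ = h⁻¹ * c
      rw [← mul_assoc (b _), ← h1, mul_assoc h⁻¹, mul_assoc h⁻¹, h2]
    have heq := Set.eq_of_subset_of_ncard_le hsub (by
      rw [Set.ncard_image_of_injective _ (mul_right_injective h⁻¹)]
      exact ha _) (hfin _)
    have hg : g * (h⁻¹ * a) * g⁻¹ ∈ (fun c ↦ h⁻¹ * c) '' A := heq ▸ ⟨g, rfl⟩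
    obtain ⟨c, hc, hcg⟩ := hg
    refine ⟨c, hc, g * a * g⁻¹, ⟨g, rfl⟩, ?_⟩
    change c * (g * a * g⁻¹)⁻¹ = ⁅h, g⁆
    have : c = h * (g * (h⁻¹ * a) * g⁻¹) := by rw [← hcg]; group
    rw [this, commutatorElement_def]
    group
  -- With `x = th⁻¹`, `t` one of finitely many coset representatives, `⁅x, g⁆ = t⁅h⁻¹, g⁆t⁻¹ ·
  -- t(gt⁻¹g⁻¹)`.
  refine Set.Finite.subset (s := ⋃ q : G ⧸ C, Set.image2
    (fun u v ↦ q.out * u * q.out⁻¹ * (q.out * v)) Φ (Set.range fun g ↦ g * q.out⁻¹ * g⁻¹))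
    (Set.finite_iUnion fun q ↦ hΦ.image2 _ (hfin _)) ?_
  rintro _ ⟨x, g, rfl⟩
  refine Set.mem_iUnion.2 ⟨(x : G ⧸ C), ?_⟩
  obtain ⟨h, hh⟩ := QuotientGroup.mk_out_eq_mul C x
  set t := (x : G ⧸ C).out
  refine ⟨⁅(h : G)⁻¹, g⁆, key _ (inv_mem h.2) g, g * t⁻¹ * g⁻¹, ⟨g, rfl⟩, ?_⟩
  have : x = t * (h : G)⁻¹ := by rw [hh]; group
  rw [this]
  simp only [commutatorElement_def]
  group

/-- If there are only finitely many commutators and `p ^ k`-th powers are central, then the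
commutator subgroup is a finite `p`-group. -/
theorem isPGroup_commutator_of_pow_mem_center {G : Type*} [Group G] [Finite (commutatorSet G)]
    {p : ℕ} [Fact p.Prime] {k : ℕ} (hk : ∀ a : G, a ^ p ^ k ∈ Subgroup.center G) :
    IsPGroup p (commutator G) := by
  let H := closureCommutatorRepresentatives G
  have hH : IsPGroup p (H ⧸ Subgroup.center H) := by
    intro q
    obtain ⟨h, rfl⟩ := QuotientGroup.mk_surjective q
    refine ⟨k, ?_⟩
    rw [← QuotientGroup.mk_pow, QuotientGroup.eq_one_iff, Subgroup.mem_center_iff]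
    exact fun g ↦ Subtype.ext (Subgroup.mem_center_iff.1 (hk h) g)
  obtain ⟨n, hn⟩ := (IsPGroup.iff_card).1 hH
  -- Schur's theorem in quantitative form, applied to a subgroup generated by finitely many
  -- commutator representatives, whose commutator subgroup has the same order as that of `G`.
  have h := Subgroup.card_commutator_dvd_index_center_pow H
  rw [card_commutator_closureCommutatorRepresentatives, Subgroup.index, hn,
    ← pow_mul] at h
  obtain ⟨m, -, hm⟩ := (Nat.dvd_prime_pow Fact.out).1 h
  exact IsPGroup.of_card hm

/-- `⟨a⟩B / B ≅ ⟨a⟩ / (⟨a⟩ ∩ B)` is cyclic, generated by the class of `a`. -/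
theorem relIndex_sup_zpowers_dvd {G : Type*} [Group G] {B : Subgroup G} {a : G} {m : ℕ}
    (ha : a ∈ Subgroup.normalizer (B : Set G)) (ham : a ^ m ∈ B) :
    B.relIndex (Subgroup.zpowers a ⊔ B) ∣ m := by
  have hle : Subgroup.zpowers a ≤ Subgroup.normalizer (B : Set G) := Subgroup.zpowers_le.2 ha
  have hB := Subgroup.normal_subgroupOf_of_le_normalizer hle
  have hsup := Subgroup.normal_subgroupOf_sup_of_le_normalizer hle
  have e := QuotientGroup.quotientInfEquivProdNormalizerQuotient _ _ hle
  rw [Subgroup.relIndex, Subgroup.index, ← Nat.card_congr e.toEquiv]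
  let q : Subgroup.zpowers a ⧸ B.subgroupOf (Subgroup.zpowers a) :=
    QuotientGroup.mk ⟨a, Subgroup.mem_zpowers a⟩
  have hq : Subgroup.zpowers q = ⊤ := by
    refine eq_top_iff.2 fun r _ ↦ ?_
    obtain ⟨⟨_, n, rfl⟩, rfl⟩ := QuotientGroup.mk_surjective r
    exact ⟨n, rfl⟩
  rw [← orderOf_eq_card_of_zpowers_eq_top hq]
  refine orderOf_dvd_of_pow_eq_one ?_
  rw [← QuotientGroup.mk_pow, QuotientGroup.eq_one_iff]
  exact ham

end GroupTheory

/-! ### Units attached to a central element of order `p` -/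

section CyclicSum

variable (F : Type*) {G : Type*} [Field F] [Group G] (p : ℕ)

/-- The sum of the powers `z ^ i`, `i < p`, in the group algebra. -/
noncomputable def cyclicSum (z : G) : MonoidAlgebra F G :=
  ∑ i ∈ Finset.range p, of F G (z ^ i)

variable {F p} {z : G}

theorem cyclicSum_comm (hz : z ∈ Subgroup.center G) (r : MonoidAlgebra F G) :
    r * cyclicSum F p z = cyclicSum F p z * r := by
  rw [cyclicSum, Finset.mul_sum, Finset.sum_mul]
  exact Finset.sum_congr rfl fun i _ ↦
    (of_commute (fun g ↦ (Subgroup.mem_center_iff.1 (pow_mem hz i) g).symm) r).symm.eq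

theorem of_mul_cyclicSum (hzp : z ^ p = 1) : of F G z * cyclicSum F p z = cyclicSum F p z := by
  have h1 : of F G z * cyclicSum F p z = ∑ i ∈ Finset.range p, of F G (z ^ (i + 1)) := by
    rw [cyclicSum, Finset.mul_sum]
    exact Finset.sum_congr rfl fun i _ ↦ by rw [← map_mul, pow_succ']
  have h2 := Finset.sum_range_succ (fun i ↦ of F G (z ^ i)) p
  rw [Finset.sum_range_succ', hzp, pow_zero] at h2
  rw [h1]
  exact add_right_cancel h2

theorem cyclicSum_mul_self [CharP F p] [Fact p.Prime] (hzp : z ^ p = 1) :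
    cyclicSum F p z * cyclicSum F p z = 0 := by
  have h : ∀ i : ℕ, of F G (z ^ i) * cyclicSum F p z = cyclicSum F p z := by
    intro i
    induction i with
    | zero => rw [pow_zero, map_one, one_mul]
    | succ i ih => rw [pow_succ, map_mul, mul_assoc, of_mul_cyclicSum hzp, ih]
  nth_rw 1 [cyclicSum]
  rw [Finset.sum_mul, Finset.sum_congr rfl fun i _ ↦ h i, Finset.sum_const, Finset.card_range,
    nsmul_eq_mul, CharP.cast_eq_zero, zero_mul]

theorem cyclicSum_mul_mul_self [CharP F p] [Fact p.Prime] (hz : z ∈ Subgroup.center G)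
    (hzp : z ^ p = 1) (x y : MonoidAlgebra F G) :
    (cyclicSum F p z * x) * (cyclicSum F p z * y) = 0 := by
  rw [mul_assoc, ← mul_assoc x, cyclicSum_comm hz, mul_assoc, ← mul_assoc,
    cyclicSum_mul_self hzp, zero_mul]

theorem augmentation_cyclicSum_mul [CharP F p] (y : MonoidAlgebra F G) :
    augmentation F G (cyclicSum F p z * y) = 0 := by
  rw [map_mul, cyclicSum, map_sum, Finset.sum_congr rfl fun i _ ↦ augmentation_of F (z ^ i),
    Finset.sum_const, Finset.card_range, nsmul_eq_mul, CharP.cast_eq_zero, zero_mul, zero_mul]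

theorem cyclicSum_mul_of (x : G) :
    cyclicSum F p z * of F G x = ∑ i ∈ Finset.range p, of F G (z ^ i * x) := by
  rw [cyclicSum, Finset.sum_mul]
  simp only [← map_mul]

theorem exists_of_coeff_cyclicSum_mul_of_ne_zero {x g : G}
    (h : (cyclicSum F p z * of F G x).coeff g ≠ 0) : ∃ i : ℕ, g = z ^ i * x := by
  classical
  by_contra! hne
  refine h ?_
  rw [cyclicSum_mul_of, coeff_sum, Finsupp.finsetSum_apply]
  refine Finset.sum_eq_zero fun i _ ↦ ?_
  rw [of_apply, coeff_single, Finsupp.single_apply, if_neg (hne i).symm]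

theorem coeff_cyclicSum_mul_of_self [Fact p.Prime] (hz : orderOf z = p) (x : G) :
    (cyclicSum F p z * of F G x).coeff x = 1 := by
  classical
  rw [cyclicSum_mul_of, coeff_sum, Finsupp.finsetSum_apply,
    Finset.sum_eq_single_of_mem 0 (Finset.mem_range.2 (Fact.out : p.Prime).pos)]
  · rw [pow_zero, one_mul, of_apply, coeff_single, Finsupp.single_apply, if_pos rfl]
  · intro i hi hi0
    rw [of_apply, coeff_single, Finsupp.single_apply, if_neg]
    rw [mul_eq_right]
    intro h
    exact hi0 (Nat.eq_zero_of_dvd_of_lt (hz ▸ orderOf_dvd_of_pow_eq_one h) (Finset.mem_range.1 hi))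

theorem exists_mul_of_cyclicSum_mul_of_eq [Fact p.Prime] (hz : orderOf z = p) {x y : G}
    (h : cyclicSum F p z * of F G x = cyclicSum F p z * of F G y) : ∃ i : ℕ, x = z ^ i * y := by
  refine exists_of_coeff_cyclicSum_mul_of_ne_zero (F := F) (p := p) ?_
  rw [← h, coeff_cyclicSum_mul_of_self hz]
  exact one_ne_zero

theorem pow_orderOf_eq (hz : orderOf z = p) : z ^ p = 1 := hz ▸ pow_orderOf_eq_one z

variable [CharP F p] [Fact p.Prime] (hz : z ∈ Subgroup.center G) (hzp : orderOf z = p)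

/-- The unit `1 + ẑ y`, where `ẑ` is the sum of the powers of a central element of order `p`. -/
noncomputable def cyclicUnit (y : MonoidAlgebra F G) : normalizedUnits F G :=
  onePlus (cyclicSum F p z * y)
    ⟨2, by rw [pow_two, cyclicSum_mul_mul_self hz (pow_orderOf_eq hzp)]⟩
    (augmentation_cyclicSum_mul y)

theorem coe_cyclicUnit (y : MonoidAlgebra F G) :
    ((cyclicUnit hz hzp y : (MonoidAlgebra F G)ˣ) : MonoidAlgebra F G) =
      1 + cyclicSum F p z * y :=
  rfl

theorem cyclicUnit_eq_one_iff {y : MonoidAlgebra F G} :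
    cyclicUnit hz hzp y = 1 ↔ cyclicSum F p z * y = 0 := by
  constructor
  · intro h
    have := congrArg (fun v : normalizedUnits F G ↦
      ((v : (MonoidAlgebra F G)ˣ) : MonoidAlgebra F G)) h
    exact add_eq_left.1 this
  · intro h
    refine normalizedUnits_ext ?_
    rw [coe_cyclicUnit, h, add_zero]
    rfl

/-- Because `ẑ` is central of square zero, `y ↦ 1 + ẑy` turns sums into products and commutes with
conjugation by `a`. -/
theorem commutatorElement_ofUnits_cyclicUnit (a : G) (y : MonoidAlgebra F G) :
    ⁅ofUnits F a, cyclicUnit hz hzp y⁆ =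
      cyclicUnit hz hzp (of F G a * y * of F G a⁻¹ - y) := by
  rw [commutatorElement_def, mul_inv_eq_iff_eq_mul]
  refine normalizedUnits_ext ?_
  have h := cyclicSum_mul_mul_self (F := F) hz (pow_orderOf_eq hzp)
    (of F G a * y * of F G a⁻¹ - y) y
  have h1 : of F G a * of F G a⁻¹ = 1 := by rw [← map_mul, mul_inv_cancel, map_one]
  change of F G a * (1 + cyclicSum F p z * y) * of F G a⁻¹ =
    (1 + cyclicSum F p z * (of F G a * y * of F G a⁻¹ - y)) * (1 + cyclicSum F p z * y)
  rw [add_mul 1, mul_add (cyclicSum F p z * _), h, mul_add, ← mul_assoc, cyclicSum_comm hz, mul_one,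
    add_mul, h1]
  noncomm_ring

theorem cyclicUnit_mem_lowerCentralSeries_succ {n : ℕ} {y : MonoidAlgebra F G} (a : G)
    (hy : cyclicUnit hz hzp y ∈ (⊤ : Subgroup (normalizedUnits F G)).lowerCentralSeries n) :
    cyclicUnit hz hzp (of F G a * y * of F G a⁻¹ - y) ∈
      (⊤ : Subgroup (normalizedUnits F G)).lowerCentralSeries (n + 1) := by
  rw [← commutatorElement_ofUnits_cyclicUnit, ← inv_mem_iff, commutatorElement_inv]
  exact Subgroup.commutator_mem_commutator hy (Subgroup.mem_top _)

variable (F) in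
/-- Conjugation by a group element, as a linear endomorphism of the group algebra. -/
noncomputable def conjEnd : G →* Module.End F (MonoidAlgebra F G) where
  toFun a := LinearMap.mulLeft F (of F G a) * LinearMap.mulRight F (of F G a⁻¹)
  map_one' := by ext; simp
  map_mul' a b := by
    refine LinearMap.ext fun x ↦ ?_
    simp only [Module.End.mul_apply, LinearMap.mulLeft_apply, LinearMap.mulRight_apply, map_mul,
      mul_inv_rev, mul_assoc]

theorem conjEnd_apply (a : G) (x : MonoidAlgebra F G) :
    conjEnd F a x = of F G a * x * of F G a⁻¹ := by
  simp [conjEnd, mul_assoc]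

theorem conjEnd_of (a x : G) : conjEnd F a (of F G x) = of F G (a * x * a⁻¹) := by
  rw [conjEnd_apply, map_mul, map_mul]

/-- If `V(FG)` is nilpotent, sufficiently high `p`-power conjugation is trivial modulo `⟨z⟩`. -/
theorem exists_pow_conj_eq (hz : z ∈ Subgroup.center G) (hzp : orderOf z = p) {n k : ℕ}
    (hn : (⊤ : Subgroup (normalizedUnits F G)).lowerCentralSeries n = ⊥) (hk : n ≤ p ^ k)
    (a x : G) : ∃ i : ℕ, a ^ p ^ k * x * (a ^ p ^ k)⁻¹ = z ^ i * x := by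
  have h1 : ∀ j, cyclicUnit hz hzp (((conjEnd F a - 1) ^ j) (of F G x)) ∈
      (⊤ : Subgroup (normalizedUnits F G)).lowerCentralSeries j := by
    intro j
    induction j with
    | zero => exact Subgroup.mem_top _
    | succ j ih =>
      have := cyclicUnit_mem_lowerCentralSeries_succ hz hzp a ih
      rwa [pow_succ', Module.End.mul_apply, LinearMap.sub_apply, conjEnd_apply,
        Module.End.one_apply]
  have h2 := Subgroup.lowerCentralSeries_antitone _ hk (h1 (p ^ k))
  have : CharP (Module.End F (MonoidAlgebra F G)) p :=
    charP_of_injective_algebraMap (algebraMap F _).injective p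
  -- In characteristic `p`, `(conjEnd F a - 1) ^ p ^ k = conjEnd F (a ^ p ^ k) - 1`.
  rw [hn, Subgroup.mem_bot, cyclicUnit_eq_one_iff, sub_pow_char_pow_of_commute _ _
    (Commute.one_right _), one_pow, ← map_pow, LinearMap.sub_apply, conjEnd_of, mul_sub,
    Module.End.one_apply, sub_eq_zero] at h2
  exact exists_mul_of_cyclicSum_mul_of_eq hzp h2

theorem pow_mem_center_of_lowerCentralSeries (hz : z ∈ Subgroup.center G) (hzp : orderOf z = p)
    {n k : ℕ}
    (hn : (⊤ : Subgroup (normalizedUnits F G)).lowerCentralSeries n = ⊥) (hk : n ≤ p ^ k)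
    (a : G) : a ^ p ^ (k + 1) ∈ Subgroup.center G := by
  refine Subgroup.mem_center_iff.2 fun x ↦ ?_
  obtain ⟨i, hi⟩ := exists_pow_conj_eq hz hzp hn hk a x
  set b := a ^ p ^ k
  -- Taking `m = p` kills the factor in `⟨z⟩`; this is the reason for the exponent `k + 1`.
  have h : ∀ m : ℕ, b ^ m * x * (b ^ m)⁻¹ = (z ^ i) ^ m * x := by
    intro m
    induction m with
    | zero => simp
    | succ m ih =>
      have hc := Subgroup.mem_center_iff.1 (pow_mem (pow_mem hz i) m) b
      calc b ^ (m + 1) * x * (b ^ (m + 1))⁻¹ = b * (b ^ m * x * (b ^ m)⁻¹) * b⁻¹ := by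
            rw [pow_succ']; group
        _ = (z ^ i) ^ m * (b * x * b⁻¹) := by rw [ih, ← mul_assoc b, hc]; group
        _ = _ := by rw [hi, pow_succ, mul_assoc]
  have hp := h p
  rw [← pow_mul z, mul_comm i, pow_mul z, pow_orderOf_eq hzp, one_pow, one_mul,
    mul_inv_eq_iff_eq_mul, ← pow_mul, ← pow_succ] at hp
  exact hp.symm

end CyclicSum

/-! ### Bounded conjugacy classes from nilpotence of the units -/

section ConjugacyClasses

variable {F G : Type*} [Field F] [Group G] {p : ℕ} {z : G}

theorem coeff_conj (a : G) (w : MonoidAlgebra F G) (g : G) :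
    (of F G a * w * of F G a⁻¹).coeff g = w.coeff (a⁻¹ * g * a) := by
  rw [of_apply, of_apply, coeff_mul_single_apply, coeff_single_mul_apply, inv_inv, mul_one,
    one_mul, mul_assoc]

variable [CharP F p] [Fact p.Prime]

/-- The subgroup of elements commuting with `x` modulo `⟨z⟩`. -/
def centralizerMod (z x : G) [(Subgroup.zpowers z).Normal] : Subgroup G :=
  (Subgroup.centralizer {QuotientGroup.mk' (Subgroup.zpowers z) x}).comap
    (QuotientGroup.mk' (Subgroup.zpowers z))

theorem mem_centralizerMod [(Subgroup.zpowers z).Normal] {x g : G} :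
    g ∈ centralizerMod z x ↔
      (g : G ⧸ Subgroup.zpowers z) * (x : G ⧸ Subgroup.zpowers z) = x * g :=
  Subgroup.mem_centralizer_singleton_iff

/-- A unit `1 + ẑ y` in the `j`-th term of the lower central series whose support consists of
conjugates of `x` (modulo `⟨z⟩`) under a subgroup `B` persists to the next term of the series, for
a subgroup that is larger than `B` by a factor of at most `p`. -/
theorem exists_larger_subgroup [Group.IsNilpotent G] [(Subgroup.zpowers z).Normal]
    (hz : z ∈ Subgroup.center G) (hzp : orderOf z = p) {x : G} {k j : ℕ}
    (hk : ∀ a : G, a ^ p ^ k ∈ centralizerMod z x) {B : Subgroup G} (hCB : centralizerMod z x ≤ B)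
    (hB : B ≠ ⊤) {y : MonoidAlgebra F G} (hy0 : cyclicSum F p z * y ≠ 0)
    (hy : cyclicUnit hz hzp y ∈ (⊤ : Subgroup (normalizedUnits F G)).lowerCentralSeries j)
    (hsupp : ∀ g, (cyclicSum F p z * y).coeff g ≠ 0 →
      ∃ b ∈ B, (g : G ⧸ Subgroup.zpowers z) = b * x * (b : G ⧸ Subgroup.zpowers z)⁻¹) :
    ∃ B' : Subgroup G, B ≤ B' ∧ B.relIndex B' ∣ p ∧ ∃ y' : MonoidAlgebra F G,
      cyclicSum F p z * y' ≠ 0 ∧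
      cyclicUnit hz hzp y' ∈
        (⊤ : Subgroup (normalizedUnits F G)).lowerCentralSeries (j + 1) ∧
      ∀ g, (cyclicSum F p z * y').coeff g ≠ 0 →
        ∃ b ∈ B', (g : G ⧸ Subgroup.zpowers z) = b * x * (b : G ⧸ Subgroup.zpowers z)⁻¹ := by
  classical
  -- The normalizer condition gives an element of the normalizer outside `B`; some `p`-power of it
  -- lies in `B`, and the last one that does not is taken as `a`.
  obtain ⟨a, haN, haB, hap⟩ : ∃ a ∈ Subgroup.normalizer (B : Set G), a ∉ B ∧ a ^ p ∈ B := by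
    obtain ⟨a, haN, haB⟩ := SetLike.exists_of_lt
      (Group.normalizerCondition_of_isNilpotent B (lt_top_iff_ne_top.2 hB))
    have hex : ∃ m, a ^ p ^ m ∈ B := ⟨k, hCB (hk a)⟩
    have hpos : 0 < Nat.find hex := by
      rw [Nat.pos_iff_ne_zero]
      intro h0
      have := Nat.find_spec hex
      rw [h0, pow_zero, pow_one] at this
      exact haB this
    refine ⟨a ^ p ^ (Nat.find hex - 1), pow_mem haN _, Nat.find_min hex (by omega), ?_⟩
    rw [← pow_mul, ← pow_succ, Nat.sub_add_cancel hpos]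
    exact Nat.find_spec hex
  have hw : cyclicSum F p z * (of F G a * y * of F G a⁻¹ - y) =
      of F G a * (cyclicSum F p z * y) * of F G a⁻¹ - cyclicSum F p z * y := by
    rw [mul_sub, ← mul_assoc (of F G a), cyclicSum_comm hz, ← mul_assoc, ← mul_assoc]
  refine ⟨Subgroup.zpowers a ⊔ B, le_sup_right, relIndex_sup_zpowers_dvd haN hap,
    of F G a * y * of F G a⁻¹ - y, ?_, cyclicUnit_mem_lowerCentralSeries_succ hz hzp a hy, ?_⟩
  -- If conjugation by `a` fixed `ẑy`, some `g` and `a⁻¹ga` would both be `B`-conjugates of `x`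
  -- modulo `⟨z⟩`, say by `b` and `c`. Then `b⁻¹ac` centralizes `x` modulo `⟨z⟩`, which forces `a ∈
  -- B`.
  · rw [hw]
    intro h0
    rw [sub_eq_zero] at h0
    obtain ⟨g, hg⟩ : ∃ g, (cyclicSum F p z * y).coeff g ≠ 0 := by
      by_contra! hall
      exact hy0 (coeff_eq_zero.1 (Finsupp.ext hall))
    obtain ⟨b, hb, hgb⟩ := hsupp g hg
    rw [← h0, coeff_conj] at hg
    obtain ⟨c, hc, hgc⟩ := hsupp _ hg
    rw [QuotientGroup.mk_mul, QuotientGroup.mk_mul, QuotientGroup.mk_inv, hgb] at hgc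
    have hmem : b⁻¹ * a * c ∈ B := by
      refine hCB (mem_centralizerMod.2 ?_)
      rw [QuotientGroup.mk_mul, QuotientGroup.mk_mul, QuotientGroup.mk_inv]
      set a' := (a : G ⧸ Subgroup.zpowers z)
      set b' := (b : G ⧸ Subgroup.zpowers z)
      set c' := (c : G ⧸ Subgroup.zpowers z)
      set x' := (x : G ⧸ Subgroup.zpowers z)
      calc b'⁻¹ * a' * c' * x' = b'⁻¹ * a' * (c' * x' * c'⁻¹) * c' := by group
        _ = x' * (b'⁻¹ * a' * c') := by rw [← hgc]; group
    refine haB ?_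
    have := mul_mem (mul_mem hb hmem) (inv_mem hc)
    rwa [show b * (b⁻¹ * a * c) * c⁻¹ = a by group] at this
  · intro g hg
    rw [hw, coeff_sub, Finsupp.sub_apply, coeff_conj] at hg
    by_cases h1 : (cyclicSum F p z * y).coeff g = 0
    · rw [h1, sub_zero] at hg
      obtain ⟨b, hb, hgb⟩ := hsupp _ hg
      refine ⟨a * b, mul_mem (Subgroup.mem_sup_left (Subgroup.mem_zpowers a))
        (Subgroup.mem_sup_right hb), ?_⟩
      rw [QuotientGroup.mk_mul, QuotientGroup.mk_mul, QuotientGroup.mk_inv] at hgb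
      rw [QuotientGroup.mk_mul]
      calc (g : G ⧸ Subgroup.zpowers z) = a * ((a : G ⧸ Subgroup.zpowers z)⁻¹ * g * a) *
            (a : G ⧸ Subgroup.zpowers z)⁻¹ := by group
        _ = _ := by rw [hgb]; group
    · obtain ⟨b, hb, hgb⟩ := hsupp _ h1
      exact ⟨b, Subgroup.mem_sup_right hb, hgb⟩

theorem index_centralizerMod [Group.IsNilpotent G] [(Subgroup.zpowers z).Normal]
    (hz : z ∈ Subgroup.center G) (hzp : orderOf z = p) {n k : ℕ}
    (hn : (⊤ : Subgroup (normalizedUnits F G)).lowerCentralSeries n = ⊥) {x : G}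
    (hk : ∀ a : G, a ^ p ^ k ∈ centralizerMod z x) :
    (centralizerMod z x).index ≠ 0 ∧ (centralizerMod z x).index ≤ p ^ n := by
  have hp : 0 < p := (Fact.out : p.Prime).pos
  -- Either the chain of subgroups has already reached `G`, or a nontrivial unit survives in term
  -- `j`. At `j = n` the series is trivial, so only the first case remains.
  have key : ∀ j, ((centralizerMod z x).index ≠ 0 ∧ (centralizerMod z x).index ≤ p ^ j) ∨
      ∃ B : Subgroup G, centralizerMod z x ≤ B ∧ (centralizerMod z x).relIndex B ≠ 0 ∧
        (centralizerMod z x).relIndex B ≤ p ^ j ∧ ∃ y : MonoidAlgebra F G,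
          cyclicSum F p z * y ≠ 0 ∧
          cyclicUnit hz hzp y ∈ (⊤ : Subgroup (normalizedUnits F G)).lowerCentralSeries j ∧
          ∀ g, (cyclicSum F p z * y).coeff g ≠ 0 →
            ∃ b ∈ B, (g : G ⧸ Subgroup.zpowers z) = b * x * (b : G ⧸ Subgroup.zpowers z)⁻¹ := by
    intro j
    induction j with
    | zero =>
      refine Or.inr ⟨_, le_rfl, by simp, by simp, of F G x, ?_, Subgroup.mem_top _, ?_⟩
      · intro h
        have := coeff_cyclicSum_mul_of_self (F := F) hzp x
        rw [h] at this
        exact zero_ne_one this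
      · intro g hg
        obtain ⟨i, rfl⟩ := exists_of_coeff_cyclicSum_mul_of_ne_zero hg
        refine ⟨1, one_mem _, ?_⟩
        rw [QuotientGroup.mk_mul, (QuotientGroup.eq_one_iff (z ^ i)).2
          (Subgroup.npow_mem_zpowers z i), QuotientGroup.mk_one]
        group
    | succ j ih =>
      have hle : p ^ j ≤ p ^ (j + 1) := Nat.pow_le_pow_right hp j.le_succ
      obtain ⟨h0, h1⟩ | ⟨B, hCB, h0, h1, y, hy0, hy, hsupp⟩ := ih
      · exact Or.inl ⟨h0, h1.trans hle⟩
      · by_cases hB : B = ⊤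
        · rw [hB, Subgroup.relIndex_top_right] at h0 h1
          exact Or.inl ⟨h0, h1.trans hle⟩
        · obtain ⟨B', hBB', hdvd, hy'⟩ := exists_larger_subgroup hz hzp hk hCB hB hy0 hy hsupp
          refine Or.inr ⟨B', hCB.trans hBB', ?_, ?_, hy'⟩
          · rw [← Subgroup.relIndex_mul_relIndex _ _ _ hCB hBB']
            exact mul_ne_zero h0 (ne_zero_of_dvd_ne_zero hp.ne' hdvd)
          · rw [← Subgroup.relIndex_mul_relIndex _ _ _ hCB hBB', pow_succ]
            exact Nat.mul_le_mul h1 (Nat.le_of_dvd hp hdvd)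
  obtain h | ⟨B, -, -, -, y, hy0, hy, -⟩ := key n
  · exact h
  · rw [hn, Subgroup.mem_bot, cyclicUnit_eq_one_iff] at hy
    exact absurd hy hy0

/-- A conjugate of `x` is determined by a coset of `centralizerMod z x` together with one of the `p`
elements of `⟨z⟩`. -/
theorem finite_conj_of_index [(Subgroup.zpowers z).Normal]
    (hzp : orderOf z = p) {x : G} {m : ℕ}
    (h0 : (centralizerMod z x).index ≠ 0) (hm : (centralizerMod z x).index ≤ m) :
    (Set.range fun g ↦ g * x * g⁻¹).Finite ∧ (Set.range fun g ↦ g * x * g⁻¹).ncard ≤ m * p := by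
  have hfo : IsOfFinOrder z := orderOf_pos_iff.1 (hzp ▸ (Fact.out : p.Prime).pos)
  have : Finite (Subgroup.zpowers z) := hfo.finite_zpowers
  have : Finite (G ⧸ centralizerMod z x) := Nat.finite_of_card_ne_zero h0
  let φ : (G ⧸ centralizerMod z x) × Subgroup.zpowers z → G :=
    fun q ↦ q.2 * (q.1.out * x * q.1.out⁻¹)
  have hsub : (Set.range fun g ↦ g * x * g⁻¹) ⊆ Set.range φ := by
    rintro _ ⟨g, rfl⟩
    obtain ⟨h, hh⟩ := QuotientGroup.mk_out_eq_mul (centralizerMod z x) g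
    set t := (g : G ⧸ centralizerMod z x).out
    have hmem : g * x * g⁻¹ * (t * x * t⁻¹)⁻¹ ∈ Subgroup.zpowers z := by
      rw [← QuotientGroup.eq_one_iff]
      have h1 := mem_centralizerMod.1 h.2
      rw [hh]
      simp only [QuotientGroup.mk_mul, QuotientGroup.mk_inv]
      set g' := (g : G ⧸ Subgroup.zpowers z)
      set h' := ((h : G) : G ⧸ Subgroup.zpowers z)
      set x' := (x : G ⧸ Subgroup.zpowers z)
      calc g' * x' * g'⁻¹ * (g' * h' * x' * (g' * h')⁻¹)⁻¹
          = g' * x' * g'⁻¹ * (g' * (h' * x') * (g' * h')⁻¹)⁻¹ := by group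
        _ = 1 := by rw [h1]; group
    exact ⟨((g : G ⧸ centralizerMod z x), ⟨_, hmem⟩), inv_mul_cancel_right _ _⟩
  have hfin : (Set.range φ).Finite := Set.finite_range φ
  refine ⟨hfin.subset hsub, (Set.ncard_le_ncard hsub hfin).trans ?_⟩
  calc (Set.range φ).ncard ≤ Nat.card ((G ⧸ centralizerMod z x) × Subgroup.zpowers z) :=
        Finite.card_range_le φ
    _ ≤ m * p := by
      rw [Nat.card_prod, Nat.card_zpowers, hzp]
      exact Nat.mul_le_mul_right p hm

variable (F p)

theorem isNilpotent_of_normalizedUnits [Group.IsNilpotent (normalizedUnits F G)] :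
    Group.IsNilpotent G :=
  Subgroup.isNilpotent_of_ker_le_center (ofUnits F) (by
    rw [(MonoidHom.ker_eq_bot_iff _).2 (ofUnits_injective F)]; exact bot_le)

/-- If the normalized units of a modular group algebra form a nilpotent group, then all `p ^ k`-th
powers in `G` are central for some `k`, and `G'` is a finite `p`-group. -/
theorem structure_of_isNilpotent_normalizedUnits [hV : Group.IsNilpotent (normalizedUnits F G)]
    (hmod : ∃ g : G, orderOf g = p) :
    (∃ k, ∀ a : G, a ^ p ^ k ∈ Subgroup.center G) ∧ Finite (commutator G) ∧
      IsPGroup p (commutator G) := by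
  have hG := isNilpotent_of_normalizedUnits F (G := G)
  obtain ⟨z, hz, hzp⟩ := exists_mem_center_orderOf_eq hmod
  obtain ⟨n, hn⟩ := (Subgroup.nilpotent_iff_lowerCentralSeries).1 hV
  have hnp : n ≤ p ^ n := (Nat.lt_pow_self (Fact.out : p.Prime).one_lt).le
  have hk := pow_mem_center_of_lowerCentralSeries hz hzp hn hnp
  have := normal_zpowers_of_mem_center hz
  have hclass : ∀ x : G, (Set.range fun g ↦ g * x * g⁻¹).Finite ∧
      (Set.range fun g ↦ g * x * g⁻¹).ncard ≤ p ^ n * p := by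
    intro x
    obtain ⟨h0, h1⟩ := index_centralizerMod hz hzp hn (x := x) (k := n + 1) fun a ↦ by
      rw [mem_centralizerMod, ← QuotientGroup.mk_mul, ← QuotientGroup.mk_mul,
        (Subgroup.mem_center_iff.1 (hk a) x)]
    exact finite_conj_of_index hzp h0 h1
  have := finite_commutatorSet_of_bounded_conj _ (fun x ↦ (hclass x).1) (fun x ↦ (hclass x).2)
  exact ⟨⟨_, hk⟩, inferInstance, isPGroup_commutator_of_pow_mem_center hk⟩

end ConjugacyClasses

/-! ### Torsion in groups whose commutator subgroup is a finite `p`-group -/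

section Torsion

variable {G : Type*} [Group G] {p : ℕ}

theorem pow_mul_inv_mem_commutator (a b : G) (n : ℕ) :
    (a * b) ^ n * (a ^ n * b ^ n)⁻¹ ∈ commutator G := by
  rw [← Abelianization.ker_of, MonoidHom.mem_ker]
  rw [map_mul, map_inv, map_mul, map_pow, map_pow, map_pow, map_mul, mul_pow, mul_inv_cancel]

/-- If the commutator subgroup is a `p`-group, the `p`-elements form a subgroup. -/
def pElements (p : ℕ) (hp : IsPGroup p (commutator G)) : Subgroup G where
  carrier := {g | ∃ k, g ^ p ^ k = 1}
  one_mem' := ⟨0, one_pow _⟩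
  mul_mem' := by
    rintro a b ⟨k, hk⟩ ⟨l, hl⟩
    have h := pow_mul_inv_mem_commutator a b (p ^ (k + l))
    rw [pow_add, pow_mul a, hk, mul_comm (p ^ k), pow_mul b, hl, one_pow, one_pow, mul_one, inv_one,
      mul_one] at h
    obtain ⟨m, hm⟩ := hp ⟨_, h⟩
    refine ⟨l + k + m, ?_⟩
    rw [pow_add, pow_mul, pow_add]
    exact congrArg Subtype.val hm
  inv_mem' := by
    rintro a ⟨k, hk⟩
    exact ⟨k, by rw [inv_pow, hk, inv_one]⟩

instance pElements_normal (hp : IsPGroup p (commutator G)) : (pElements p hp).Normal where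
  conj_mem := by
    rintro a ⟨k, hk⟩ g
    exact ⟨k, by rw [conj_pow, hk, mul_one, mul_inv_cancel]⟩

theorem isPGroup_pElements (hp : IsPGroup p (commutator G)) : IsPGroup p (pElements p hp) :=
  fun ⟨_, k, hk⟩ ↦ ⟨k, Subtype.ext hk⟩

theorem commutator_le_pElements (hp : IsPGroup p (commutator G)) :
    commutator G ≤ pElements p hp := fun g hg ↦ by
  obtain ⟨k, hk⟩ := hp ⟨g, hg⟩
  exact ⟨k, congrArg Subtype.val hk⟩

/-- A maximal `p`-subgroup containing all `p`-elements. -/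
def sylowOfContains {N : Subgroup G} (hN : IsPGroup p N) (h : ∀ g, (∃ k, g ^ p ^ k = 1) → g ∈ N) :
    Sylow p G where
  toSubgroup := N
  isPGroup' := hN
  is_maximal' := fun {Q} hQ hle ↦ le_antisymm (fun g hg ↦ h g (by
    obtain ⟨k, hk⟩ := hQ ⟨g, hg⟩
    exact ⟨k, congrArg Subtype.val hk⟩)) hle

theorem eq_sylowOfContains {N : Subgroup G} (hN : IsPGroup p N)
    (h : ∀ g, (∃ k, g ^ p ^ k = 1) → g ∈ N) (Q : Sylow p G) : Q = sylowOfContains hN h := by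
  refine Sylow.ext (Q.is_maximal' hN fun g hg ↦ h g ?_).symm
  obtain ⟨k, hk⟩ := Q.isPGroup' ⟨g, hg⟩
  exact ⟨k, congrArg Subtype.val hk⟩

/-- Taking powers is multiplicative modulo `G'`, so a product of torsion elements has a power in the
finite group `G'`. -/
theorem coe_torsionSubgroup [Finite (commutator G)] :
    (torsionSubgroup G : Set G) = torsionPart G := by
  let K : Subgroup G :=
    { carrier := torsionPart G
      one_mem' := IsOfFinOrder.one
      mul_mem' := by
        intro a b ha hb
        obtain ⟨m, hm, ham⟩ := isOfFinOrder_iff_pow_eq_one.1 ha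
        obtain ⟨n, hn, hbn⟩ := isOfFinOrder_iff_pow_eq_one.1 hb
        have h := pow_mul_inv_mem_commutator a b (m * n)
        rw [pow_mul a, ham, mul_comm m, pow_mul b, hbn, one_pow, one_pow, mul_one, inv_one,
          mul_one] at h
        obtain ⟨r, hr, hab⟩ := isOfFinOrder_iff_pow_eq_one.1
          (isOfFinOrder_of_finite (⟨_, h⟩ : commutator G))
        refine isOfFinOrder_iff_pow_eq_one.2 ⟨n * m * r, by positivity, ?_⟩
        rw [pow_mul]
        exact congrArg Subtype.val hab
      inv_mem' := fun ha ↦ IsOfFinOrder.inv ha }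
  have hK : K.Normal := ⟨fun a ha g ↦ by
    obtain ⟨m, hm, ham⟩ := isOfFinOrder_iff_pow_eq_one.1 ha
    exact isOfFinOrder_iff_pow_eq_one.2
      ⟨m, hm, by rw [conj_pow, ham, mul_one, mul_inv_cancel]⟩⟩
  refine Set.Subset.antisymm ?_ Subgroup.subset_normalClosure
  exact Subgroup.normalClosure_le_normal (N := K) (le_refl (K : Set G))

theorem mem_torsionSubgroup [Finite (commutator G)] {g : G} :
    g ∈ torsionSubgroup G ↔ IsOfFinOrder g := by
  rw [← SetLike.mem_coe, coe_torsionSubgroup]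
  rfl

variable (G p) in
/-- The central elements of finite order prime to `p`. -/
def centralPrimeTo : Subgroup G where
  carrier := {g | g ∈ Subgroup.center G ∧ ∃ m, m.Coprime p ∧ g ^ m = 1}
  one_mem' := ⟨one_mem _, 1, Nat.coprime_one_left p, one_pow _⟩
  mul_mem' := by
    rintro a b ⟨ha, m, hm, ham⟩ ⟨hb, n, hn, hbn⟩
    refine ⟨mul_mem ha hb, m * n, Nat.Coprime.mul_left hm hn, ?_⟩
    rw [Commute.mul_pow (Subgroup.mem_center_iff.1 hb a), pow_mul, ham, one_pow, mul_comm m,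
      pow_mul, hbn, one_pow, one_mul]
  inv_mem' := by
    rintro a ⟨ha, m, hm, ham⟩
    exact ⟨inv_mem ha, m, hm, by rw [inv_pow, ham, inv_one]⟩

theorem centralPrimeTo_le_center : centralPrimeTo G p ≤ Subgroup.center G := fun _ h ↦ h.1

theorem mem_of_pow_mem_of_coprime {N : Subgroup G} {g : G} {m n : ℕ} (hmn : m.Coprime n)
    (hm : g ^ m ∈ N) (hn : g ^ n ∈ N) : g ∈ N := by
  have h : g = (g ^ m) ^ (m.gcdA n) * (g ^ n) ^ (m.gcdB n) := by
    rw [← zpow_natCast, ← zpow_natCast, ← zpow_mul, ← zpow_mul, ← zpow_add, ← Nat.gcd_eq_gcd_ab,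
      hmn.gcd_eq_one, Nat.cast_one, zpow_one]
  rw [h]
  exact mul_mem (zpow_mem hm _) (zpow_mem hn _)

theorem eq_one_of_mem_centralPrimeTo {g : G} (hg : g ∈ centralPrimeTo G p)
    (hgp : ∃ k, g ^ p ^ k = 1) : g = 1 := by
  obtain ⟨-, m, hm, hgm⟩ := hg
  obtain ⟨k, hk⟩ := hgp
  exact Subgroup.mem_bot.1 (mem_of_pow_mem_of_coprime (N := ⊥) (hm.pow_right k)
    (Subgroup.mem_bot.2 hgm) (Subgroup.mem_bot.2 hk))

theorem disjoint_pElements_centralPrimeTo (hp : IsPGroup p (commutator G)) :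
    Disjoint (pElements p hp) (centralPrimeTo G p) :=
  Subgroup.disjoint_def.2 fun h h' ↦ eq_one_of_mem_centralPrimeTo h' h

theorem pElements_sup_centralPrimeTo [Fact p.Prime] [Finite (commutator G)]
    (hp : IsPGroup p (commutator G)) (hk : ∃ k, ∀ a : G, a ^ p ^ k ∈ Subgroup.center G) :
    pElements p hp ⊔ centralPrimeTo G p = torsionSubgroup G := by
  have hp0 : 0 < p := (Fact.out : p.Prime).pos
  refine le_antisymm (sup_le ?_ ?_) ?_
  · rintro g ⟨k, hk⟩
    exact mem_torsionSubgroup.2 (isOfFinOrder_iff_pow_eq_one.2 ⟨p ^ k, by positivity, hk⟩)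
  · rintro g ⟨-, m, hm, hgm⟩
    refine mem_torsionSubgroup.2 (isOfFinOrder_iff_pow_eq_one.2 ⟨m, ?_, hgm⟩)
    refine Nat.pos_of_ne_zero fun h0 ↦ ?_
    rw [h0, Nat.coprime_zero_left] at hm
    exact (Fact.out : p.Prime).one_lt.ne' hm
  · intro g hg
    obtain ⟨N, hN, hgN⟩ := isOfFinOrder_iff_pow_eq_one.1 (mem_torsionSubgroup.1 hg)
    obtain ⟨s, m, hm, rfl⟩ := Nat.exists_eq_pow_mul_and_not_dvd hN.ne' p
      (Fact.out : p.Prime).one_lt.ne'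
    have hcop : m.Coprime p := ((Nat.Prime.coprime_iff_not_dvd Fact.out).2 hm).symm
    refine mem_of_pow_mem_of_coprime (hcop.pow_right s) (Subgroup.mem_sup_left ?_)
      (Subgroup.mem_sup_right ?_)
    · exact ⟨s, by rw [← pow_mul, mul_comm, hgN]⟩
    · have h1 : (g ^ p ^ s) ^ m = 1 := by rw [← pow_mul, hgN]
      obtain ⟨k, hk⟩ := hk
      -- The element `g ^ p ^ s` has both its `m`-th power (trivial) and its `p ^ k`-th power in the
      -- centre, with coprime exponents, so it is itself central.
      refine ⟨mem_of_pow_mem_of_coprime (hcop.pow_right k) ?_ (hk _), m, hcop, h1⟩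
      rw [h1]
      exact one_mem _

end Torsion

/-! ### `p`-elements of the group of normalized units -/

section Reduced

variable {F : Type*} [Field F] {p : ℕ} [Fact p.Prime] [CharP F p]

/-- The group algebra of an abelian group without `p`-torsion is reduced in characteristic `p`. -/
theorem eq_zero_of_isNilpotent {A : Type*} [Group A] (hA : ∀ a b : A, a * b = b * a)
    (hp : ∀ a : A, a ^ p = 1 → a = 1) {x : MonoidAlgebra F A} (hx : IsNilpotent x) : x = 0 := by
  have hcomm : ∀ x y : MonoidAlgebra F A, Commute x y := fun x y ↦ by
    have h : commutator A ≤ ⊥ := Subgroup.commutator_le.2 fun a _ b _ ↦ by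
      rw [Subgroup.mem_bot, commutatorElement_eq_one_iff_mul_comm, hA]
    have := mul_sub_mul_mem_relAugIdeal (F := F) h x y
    rw [relAugIdeal_bot, TwoSidedIdeal.mem_bot, sub_eq_zero] at this
    exact this
  -- The `p`-th power map is Frobenius on coefficients and `a ↦ a ^ p` on group elements; both are
  -- injective.
  have hfrob : ∀ x : MonoidAlgebra F A,
      x ^ p = mapDomain (· ^ p) (MonoidAlgebra.map (frobenius F p : F →+ F) x) := by
    intro x
    induction x using MonoidAlgebra.induction_linear with
    | zero => simp [(Fact.out : p.Prime).ne_zero]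
    | add x y hx hy =>
      rw [add_pow_char_of_commute p (hcomm x y), hx, hy, MonoidAlgebra.map_add,
        mapDomain_add]
    | single a r => simp [single_pow, frobenius_def]
  have hpinj : Function.Injective fun a : A ↦ a ^ p := fun a b hab ↦ by
    have h : (a * b⁻¹) ^ p = 1 := by
      rw [Commute.mul_pow (hA _ _), inv_pow, mul_inv_eq_one]
      exact hab
    exact mul_inv_eq_one.1 (hp _ h)
  have hinj : Function.Injective fun x : MonoidAlgebra F A ↦ x ^ p := by
    have h1 := (mapDomain_injective (R := F) hpinj).comp
      (MonoidAlgebra.map_injective (M := A) (frobenius F p : F →+ F) (frobenius_inj F p))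
    refine fun x y hxy ↦ h1 ?_
    exact (hfrob x).symm.trans (Eq.trans hxy (hfrob y))
  have h0 : ∀ n (x : MonoidAlgebra F A), x ^ p ^ n = 0 → x = 0 := by
    intro n
    induction n with
    | zero => intro x hx; simpa using hx
    | succ n ih =>
      intro x hx
      rw [pow_succ', pow_mul] at hx
      exact hinj ((ih _ hx).trans (zero_pow (Fact.out : p.Prime).ne_zero).symm)
  obtain ⟨n, hn⟩ := hx
  exact h0 n x (pow_eq_zero_of_le (Nat.lt_pow_self (Fact.out : p.Prime).one_lt).le hn)

variable {G : Type*} [Group G]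

/-- If `v ^ p ^ k = 1` then `(v - 1) ^ p ^ k = 0`, so `v - 1` vanishes in the commutative reduced
ring `F[G/P]`. -/
theorem mem_onePlusIdeal_pElements (hp : IsPGroup p (commutator G)) {v : normalizedUnits F G}
    (hv : ∃ k, v ^ p ^ k = 1) : v ∈ onePlusIdeal F (pElements p hp) := by
  rw [mem_onePlusIdeal, mem_relAugIdeal_iff]
  obtain ⟨k, hk⟩ := hv
  refine eq_zero_of_isNilpotent (p := p) (mul_comm_quotient (commutator_le_pElements hp)) ?_
    ⟨p ^ k, ?_⟩
  · intro a ha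
    obtain ⟨a, rfl⟩ := QuotientGroup.mk_surjective a
    rw [← QuotientGroup.mk_pow, QuotientGroup.eq_one_iff] at ha
    obtain ⟨m, hm⟩ := ha
    refine (QuotientGroup.eq_one_iff a).2 ⟨m + 1, ?_⟩
    rw [pow_succ', pow_mul, hm]
  · have hk' : ((v : (MonoidAlgebra F G)ˣ) : MonoidAlgebra F G) ^ p ^ k = 1 :=
      congrArg (fun v : normalizedUnits F G ↦
        ((v : (MonoidAlgebra F G)ˣ) : MonoidAlgebra F G)) hk
    rw [← map_pow, sub_pow_char_pow_of_commute _ _ (Commute.one_right _), hk', one_pow, sub_self,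
      map_zero]

theorem isPGroup_onePlusIdeal [Group.IsNilpotent G] {P : Subgroup G} [P.Normal]
    (hP : IsPGroup p P) : IsPGroup p (onePlusIdeal F P) := by
  rintro ⟨v, hv⟩
  obtain ⟨n, hn⟩ := isNilpotent_of_mem_relAugIdeal hP hv
  refine ⟨n, Subtype.ext (normalizedUnits_ext ?_)⟩
  have h := sub_pow_char_pow_of_commute p n
    (Commute.one_right ((v : (MonoidAlgebra F G)ˣ) : MonoidAlgebra F G))
  rw [pow_eq_zero_of_le (Nat.lt_pow_self (Fact.out : p.Prime).one_lt).le hn, one_pow,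
    eq_comm, sub_eq_zero] at h
  exact h

theorem setOf_onePlusIdeal [Group.IsNilpotent G] {P : Subgroup G} [P.Normal]
    (hP : IsPGroup p P) :
    {x : MonoidAlgebra F G | ∃ v ∈ onePlusIdeal F P,
      x = ((v : (MonoidAlgebra F G)ˣ) : MonoidAlgebra F G)} =
    {x : MonoidAlgebra F G | ∃ y ∈ relAugIdeal F P, x = 1 + y} := by
  ext x
  constructor
  · rintro ⟨v, hv, rfl⟩
    exact ⟨_, hv, (add_sub_cancel _ _).symm⟩
  · rintro ⟨y, hy, rfl⟩
    refine ⟨onePlus y (isNilpotent_of_mem_relAugIdeal hP hy) (augmentation_eq_zero_of_mem F hy),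
      ?_, rfl⟩
    rw [mem_onePlusIdeal, coe_onePlus, add_sub_cancel_left]
    exact hy

end Reduced

/-! ### Splitting off a finite pure subgroup of an abelian group -/

section Splitting

/-- Purity makes `f` vanish on the kernel of `D → A/kA`. The induced character extends to `A/kA`
because the circle is divisible, and its values are killed by `k`, hence lie in the copy of `ZMod
k`. -/
theorem exists_extension_zmod {A D : Type*} [AddCommGroup A] [AddCommGroup D] (i : D →+ A) (k : ℕ)
    [NeZero k] (hpure : ∀ a d, k • a = i d → ∃ d', k • d' = d) (f : D →+ ZMod k) :
    ∃ g : A →+ ZMod k, g.comp i = f := by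
  let π := QuotientAddGroup.mk' (nsmulAddMonoidHom k : A →+ A).range
  let j := π.comp i
  have hker : j.ker ≤ f.ker := fun d hd ↦ by
    obtain ⟨a, ha⟩ := (QuotientAddGroup.eq_zero_iff _).1 (AddMonoidHom.mem_ker.1 hd)
    obtain ⟨d', rfl⟩ := hpure a d ha
    rw [AddMonoidHom.mem_ker, map_nsmul, nsmul_eq_mul, CharP.cast_eq_zero, zero_mul]
  obtain ⟨h, hh⟩ := (Module.Baer.of_divisible UnitAddCircle).extension_property_addMonoidHom
    (QuotientAddGroup.kerLift j) (QuotientAddGroup.kerLift_injective j)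
    (ZMod.toAddCircle.comp (QuotientAddGroup.lift j.ker f hker))
  have hrange : ∀ q, h q ∈ (ZMod.toAddCircle (N := k)).range := by
    intro q
    have hq : k • q = 0 := by
      obtain ⟨a, rfl⟩ := QuotientAddGroup.mk_surjective q
      exact (QuotientAddGroup.eq_zero_iff (k • a)).2 ⟨a, rfl⟩
    have hhq : k • h q = 0 := by rw [← map_nsmul, hq, map_zero]
    obtain ⟨x, hx⟩ := QuotientAddGroup.mk_surjective (h q)
    rw [← hx] at hhq ⊢
    obtain ⟨m, hm⟩ := (AddCircle.coe_eq_zero_iff (1 : ℝ)).1 hhq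
    refine ⟨(m : ZMod k), ?_⟩
    rw [ZMod.toAddCircle_intCast]
    have hk : (k : ℝ) ≠ 0 := Nat.cast_ne_zero.2 (NeZero.ne k)
    have : (m : ℝ) / k = x := by
      rw [div_eq_iff hk]
      simpa [mul_comm] using hm
    rw [this]
  let e := AddMonoidHom.ofInjective (ZMod.toAddCircle_injective k)
  refine ⟨(e.symm.toAddMonoidHom.comp (h.codRestrict _ hrange)).comp π, ?_⟩
  ext d
  refine e.injective (Subtype.ext ?_)
  have := DFunLike.congr_fun hh (QuotientAddGroup.mk d)
  refine Eq.trans ?_ (this.trans (AddMonoidHom.ofInjective_apply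
    (ZMod.toAddCircle_injective k) (x := f d)).symm)
  exact congrArg Subtype.val (e.apply_symm_apply _)

/-- A finite pure subgroup of an abelian group is a direct factor. -/
theorem exists_retraction {A D : Type*} [CommGroup A] [CommGroup D] [Finite D] (i : D →* A)
    (hpure : ∀ (k : ℕ) a d, a ^ k = i d → ∃ d', d' ^ k = d) :
    ∃ ρ : A →* D, ∀ d, ρ (i d) = d := by
  obtain ⟨ι, _, n, hn, ⟨e⟩⟩ := CommGroup.equiv_prod_multiplicative_zmod_of_finite D
  have : ∀ j, NeZero (n j) := fun j ↦ ⟨(zero_lt_one.trans (hn j)).ne'⟩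
  choose g hg using fun j ↦ exists_extension_zmod (MonoidHom.toAdditive i) (n j) (hpure (n j))
    (MonoidHom.toAdditiveLeft ((Pi.evalMonoidHom _ j).comp e.toMonoidHom))
  refine ⟨e.symm.toMonoidHom.comp (MonoidHom.pi fun j ↦ MonoidHom.toAdditiveLeft.symm (g j)),
    fun d ↦ e.injective ?_⟩
  refine (e.apply_symm_apply _).trans (funext fun j ↦ ?_)
  exact congrArg Multiplicative.ofAdd (DFunLike.congr_fun (hg j) (Additive.ofMul d))

end Splitting

/-! ### Units of group algebras of torsion-free abelian groups -/

section TrivialUnits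

/-- Torsion-free abelian groups are flat over `ℤ`, hence embed in the rational vector space `ℚ ⊗ T`,
where the property is available. -/
theorem twoUniqueProds_of_isMulTorsionFree (T : Type*) [CommGroup T] [IsMulTorsionFree T] :
    TwoUniqueProds T := by
  have hflat : Module.Flat ℤ (Additive T) := inferInstance
  let f : ℤ →ₗ[ℤ] ℚ := (Int.castAddHom ℚ).toIntLinearMap
  have hf : Function.Injective f := Int.cast_injective
  have h1 := Module.Flat.rTensor_preserves_injective_linearMap (M := Additive T) f hf
  let g : Additive T →+ TensorProduct ℤ ℚ (Additive T) :=
    ((LinearMap.rTensor (Additive T) f).comp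
      (TensorProduct.lid ℤ (Additive T)).symm.toLinearMap).toAddMonoidHom
  have hg : Function.Injective g := h1.comp (TensorProduct.lid ℤ (Additive T)).symm.injective
  have h2 : TwoUniqueSums (Additive T) :=
    TwoUniqueSums.of_injective_addHom g.toAddHom hg inferInstance
  exact TwoUniqueProds.of_injective_mulHom
    (MulEquiv.multiplicativeAdditive T).symm.toMulHom
    (MulEquiv.multiplicativeAdditive T).symm.injective inferInstance

theorem exists_eq_single_of_mul_eq_one {K T : Type*} [Field K] [Group T] [TwoUniqueProds T]
    {u v : MonoidAlgebra K T} (huv : u * v = 1) : ∃ t r, r ≠ 0 ∧ u = single t r := by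
  classical
  have hu : u ≠ 0 := left_ne_zero_of_mul_eq_one huv
  have hv : v ≠ 0 := right_ne_zero_of_mul_eq_one huv
  have hu' : u.coeff.support.card ≠ 0 := by simpa using hu
  have hv' : v.coeff.support.card ≠ 0 := by simpa using hv
  have key : ∀ a ∈ u.coeff.support, ∀ b ∈ v.coeff.support,
      UniqueMul u.coeff.support v.coeff.support a b → a * b = 1 := by
    intro a ha b hb h
    have h1 : (u * v).coeff (a * b) = u.coeff a * v.coeff b := coeff_mul_mul_of_uniqueMul h
    by_contra hne
    rw [huv, one_def, coeff_single, Finsupp.single_apply, if_neg (Ne.symm hne)] at h1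
    exact mul_ne_zero (Finsupp.mem_support_iff.1 ha) (Finsupp.mem_support_iff.1 hb) h1.symm
  -- Two distinct uniquely represented products would both equal `1`, hence each other, against
  -- uniqueness.
  have hcard : ¬ 1 < u.coeff.support.card * v.coeff.support.card := by
    intro hlt
    obtain ⟨⟨a, b⟩, hab, ⟨c, d⟩, hcd, hne, hu1, hu2⟩ :=
      TwoUniqueProds.uniqueMul_of_one_lt_card hlt
    rw [Finset.mem_product] at hab hcd
    obtain ⟨h1, h2⟩ := hu1 hcd.1 hcd.2
      ((key _ hcd.1 _ hcd.2 hu2).trans (key _ hab.1 _ hab.2 hu1).symm)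
    exact hne (Prod.ext h1.symm h2.symm)
  have h1 : u.coeff.support.card = 1 := by
    have := Nat.le_mul_of_pos_right u.coeff.support.card (Nat.pos_of_ne_zero hv')
    omega
  obtain ⟨t, ht⟩ := Finset.card_eq_one.1 h1
  have ht' : t ∈ u.coeff.support := ht ▸ Finset.mem_singleton_self t
  refine ⟨t, u.coeff t, Finsupp.mem_support_iff.1 ht', ?_⟩
  refine coeff_injective ?_
  rw [coeff_single]
  exact Finsupp.eq_single_iff.2 ⟨ht.le, rfl⟩

/-- The group element underlying a unit of the group algebra of a group with only trivial units. -/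
theorem exists_unitDegree (K T : Type*) [Field K] [Group T] [TwoUniqueProds T] :
    ∃ deg : (MonoidAlgebra K T)ˣ →* T, ∀ (u : (MonoidAlgebra K T)ˣ) t r,
      (u : MonoidAlgebra K T) = single t r → deg u = t := by
  choose t r hr ht using fun u : (MonoidAlgebra K T)ˣ ↦ exists_eq_single_of_mul_eq_one u.mul_inv
  have h : ∀ (u : (MonoidAlgebra K T)ˣ) s q, (u : MonoidAlgebra K T) = single s q → t u = s := by
    intro u s q hu
    have h1 := (ht u).symm.trans hu
    obtain h2 | h2 := single_inj.1 h1
    · exact h2.1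
    · exact absurd h2.1 (hr u)
  refine ⟨MonoidHom.mk' t fun u v ↦ h _ _ (r u * r v) ?_, h⟩
  rw [Units.val_mul, ht u, ht v, single_mul_single]

end TrivialUnits

/-! ### Group algebras over finite products of fields -/

section Product

variable {R T ι : Type*} [Ring R] {K : ι → Type*} [∀ i, Field (K i)]

theorem eq_zero_of_mapRingHom_eq_zero [Monoid T] (e : R ≃+* ∀ i, K i) {u : MonoidAlgebra R T}
    (h : ∀ i, mapRingHom T ((Pi.evalRingHom K i).comp (e : R →+* ∀ i, K i)) u = 0) : u = 0 := by
  refine coeff_injective (Finsupp.ext fun t ↦ e.injective (funext fun i ↦ ?_))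
  have := congrArg (fun x ↦ x.coeff t) (h i)
  simpa using this

theorem exists_mapRingHom_eq [Monoid T] [Finite ι] (e : R ≃+* ∀ i, K i)
    (w : ∀ i, MonoidAlgebra (K i) T) :
    ∃ u, ∀ i, mapRingHom T ((Pi.evalRingHom K i).comp (e : R →+* ∀ i, K i)) u = w i := by
  classical
  cases nonempty_fintype ι
  refine ⟨ofCoeff (Finsupp.onFinset (Finset.univ.biUnion fun i ↦ (w i).coeff.support)
    (fun t ↦ e.symm fun i ↦ (w i).coeff t) fun t ht ↦ ?_), fun i ↦ ?_⟩
  · by_contra hno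
    refine ht ?_
    rw [EmbeddingLike.map_eq_zero_iff]
    funext i
    by_contra hi
    exact hno (Finset.mem_biUnion.2 ⟨i, Finset.mem_univ i, Finsupp.mem_support_iff.2 hi⟩)
  · refine coeff_injective (Finsupp.ext fun t ↦ ?_)
    simp

end Product

/-! ### Decomposing `FD` and splitting `D` off `G` -/

section Decomposition

variable {F G : Type*} [Field F] [Group G] {p : ℕ}

/-- `FD` is a reduced commutative Artinian ring, hence the product of its residue fields. -/
theorem exists_isDirectSumOfFields [Fact p.Prime] [CharP F p] (D : Type*) [Group D] [Finite D]
    (hcomm : ∀ a b : D, a * b = b * a) (hD : ∀ a : D, a ^ p = 1 → a = 1) :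
    ∃ n, IsDirectSumOfFields (MonoidAlgebra F D) n := by
  let _ : CommGroup D := { (inferInstance : Group D) with mul_comm := hcomm }
  have : Module.Finite F (MonoidAlgebra F D) := inferInstance
  have : IsArtinianRing (MonoidAlgebra F D) := IsArtinianRing.of_finite F _
  have : IsReduced (MonoidAlgebra F D) :=
    ⟨fun x hx ↦ eq_zero_of_isNilpotent (p := p) hcomm hD hx⟩
  obtain ⟨n, ⟨c⟩⟩ := Finite.exists_equiv_fin (MaximalSpectrum (MonoidAlgebra F D))
  refine ⟨n, fun i ↦ MonoidAlgebra F D ⧸ (c.symm i).asIdeal, fun i ↦ Ideal.Quotient.field _,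
    ⟨(IsArtinianRing.equivPi (MonoidAlgebra F D)).toRingEquiv.trans
      (RingEquiv.piCongrLeft' (fun I : MaximalSpectrum (MonoidAlgebra F D) ↦
        MonoidAlgebra F D ⧸ I.asIdeal) c)⟩⟩

theorem exists_retraction_centralPrimeTo [Fact p.Prime] [Finite (commutator G)]
    (hp : IsPGroup p (commutator G)) (hk : ∃ k, ∀ a : G, a ^ p ^ k ∈ Subgroup.center G) [Finite (centralPrimeTo G p)] :
    ∃ ρ : G →* centralPrimeTo G p, ∀ d : centralPrimeTo G p, ρ d = d := by
  let _ : CommGroup (centralPrimeTo G p) := { (inferInstance : Group (centralPrimeTo G p)) with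
    mul_comm := fun a b ↦ Subtype.ext (Subgroup.mem_center_iff.1 (centralPrimeTo_le_center b.2) a) }
  obtain ⟨ρ, hρ⟩ := exists_retraction
    ((Abelianization.of (G := G)).comp (centralPrimeTo G p).subtype) (by
    -- Purity of `D` in `G/G'`: for `k > 0`, `g ^ k ∈ PD` makes `g` torsion, so `g = xd'` with `x ∈
    -- P`, and `d' ^ k d⁻¹` is a `p`-element of `D`, hence trivial. For `k = 0`, `d` itself is a
    -- `p`-element.
    intro k a d had
    obtain ⟨g, rfl⟩ := QuotientGroup.mk_surjective a
    have hgd : g ^ k * (d : G)⁻¹ ∈ commutator G := by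
      rw [← Abelianization.ker_of, MonoidHom.mem_ker, map_mul, map_inv, mul_inv_eq_one, map_pow]
      exact had
    have hgP := commutator_le_pElements hp hgd
    obtain rfl | hk0 := Nat.eq_zero_or_pos k
    · rw [pow_zero, one_mul, inv_mem_iff] at hgP
      exact ⟨1, Subtype.ext ((one_pow 0).trans (eq_one_of_mem_centralPrimeTo d.2 hgP).symm)⟩
    have hsup := pElements_sup_centralPrimeTo hp hk
    have hgk : g ^ k ∈ torsionSubgroup G := by
      rw [← hsup]
      have := mul_mem (Subgroup.mem_sup_left (T := centralPrimeTo G p) hgP)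
        (Subgroup.mem_sup_right (S := pElements p hp) d.2)
      rwa [inv_mul_cancel_right] at this
    have hg : g ∈ torsionSubgroup G := by
      rw [mem_torsionSubgroup] at hgk ⊢
      exact (isOfFinOrder_pow.1 hgk).resolve_right hk0.ne'
    rw [← hsup] at hg
    obtain ⟨x, hx, d', hd', rfl⟩ := Subgroup.mem_sup_of_normal_left.1 hg
    refine ⟨⟨d', hd'⟩, Subtype.ext ?_⟩
    change d' ^ k = d
    rw [← mul_inv_eq_one]
    refine eq_one_of_mem_centralPrimeTo (mul_mem (pow_mem hd' k) (inv_mem d.2)) ?_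
    rw [Commute.mul_pow (Subgroup.mem_center_iff.1 (centralPrimeTo_le_center hd') x)] at hgP
    have := mul_mem (inv_mem (pow_mem hx k)) hgP
    rwa [mul_assoc, inv_mul_cancel_left] at this)
  exact ⟨ρ.comp Abelianization.of, hρ⟩

theorem commutator_le_torsionSubgroup [Finite (commutator G)] :
    commutator G ≤ torsionSubgroup G := fun g hg ↦
  mem_torsionSubgroup.2 ((commutator G).subtype.isOfFinOrder
    (isOfFinOrder_of_finite (⟨g, hg⟩ : commutator G)))

instance twoUniqueProds_quotient_torsionSubgroup [Finite (commutator G)] :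
    TwoUniqueProds (G ⧸ torsionSubgroup G) := by
  let _ : CommGroup (G ⧸ torsionSubgroup G) :=
    { (inferInstance : Group (G ⧸ torsionSubgroup G)) with
      mul_comm := mul_comm_quotient commutator_le_torsionSubgroup }
  have : IsMulTorsionFree (G ⧸ torsionSubgroup G) := by
    refine ⟨fun n hn a b hab ↦ ?_⟩
    have h : (a * b⁻¹) ^ n = 1 := by
      rw [mul_pow, inv_pow, mul_inv_eq_one]
      exact hab
    rw [← mul_inv_eq_one]
    obtain ⟨g, hg⟩ := QuotientGroup.mk_surjective (a * b⁻¹)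
    rw [← hg] at h ⊢
    have h' : g ^ n ∈ torsionSubgroup G := (QuotientGroup.eq_one_iff _).1 h
    refine (QuotientGroup.eq_one_iff g).2 ?_
    rw [mem_torsionSubgroup] at h' ⊢
    exact (isOfFinOrder_pow.1 h').resolve_right hn
  exact twoUniqueProds_of_isMulTorsionFree _

end Decomposition

/-! ### Normalized units modulo a nil ideal -/

section QuotientEquiv

variable {F G H T : Type*} [Field F] [Group G] [Group H] [Group T]

variable (F) in
/-- The homomorphism between groups of normalized units induced by a group homomorphism. -/
noncomputable def normalizedUnitsMap (f : G →* H) : normalizedUnits F G →* normalizedUnits F H :=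
  ((Units.map (mapDomainRingHom F f : MonoidAlgebra F G →* MonoidAlgebra F H)).comp
    (normalizedUnits F G).subtype).codRestrict _ fun v ↦ mem_normalizedUnits.2 (by
      refine (augmentation_mapDomain F f _).trans (mem_normalizedUnits.1 v.2))

theorem coe_normalizedUnitsMap (f : G →* H) (v : normalizedUnits F G) :
    ((normalizedUnitsMap F f v : (MonoidAlgebra F H)ˣ) : MonoidAlgebra F H) =
      mapDomainRingHom F f ((v : (MonoidAlgebra F G)ˣ) : MonoidAlgebra F G) :=
  rfl

/-- The ring homomorphism `F[G] → K[T]` induced by a group homomorphism `G → T` and a ring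
homomorphism `F[D] → K` composed with a group homomorphism `G → D`. -/
noncomputable def gradedHom {K D : Type*} [Semiring K] [Group D] (ρ : G →* D) (τ : G →* T)
    (κ : MonoidAlgebra F D →+* K) : MonoidAlgebra F G →+* MonoidAlgebra K T :=
  (mapRingHom T κ).comp
    ((curryRingEquiv : MonoidAlgebra F (T × D) ≃+* _).toRingHom.comp
      (mapDomainRingHom F (τ.prod ρ)))

theorem gradedHom_single {K D : Type*} [Semiring K] [Group D] (ρ : G →* D) (τ : G →* T)
    (κ : MonoidAlgebra F D →+* K) (g : G) (a : F) :
    gradedHom ρ τ κ (single g a) = single (τ g) (κ (single (ρ g) a)) := by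
  simp [gradedHom]

theorem augmentation_gradedHom {K D : Type*} [Field K] [Group D] (ρ : G →* D) (τ : G →* T)
    (κ : MonoidAlgebra F D →+* K) (x : MonoidAlgebra F G) :
    augmentation K T (gradedHom ρ τ κ x) = κ (mapDomainRingHom F ρ x) := by
  induction x using MonoidAlgebra.induction_linear with
  | zero => simp only [map_zero]
  | add x y hx hy => simp only [map_add, hx, hy]
  | single g a => rw [gradedHom_single, augmentation_single, mapDomainRingHom_apply,
      mapDomain_single]

theorem isUnit_of_mul_isUnit {R : Type*} [Monoid R] {x y : R} (h : IsUnit (x * y))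
    (h' : IsUnit (y * x)) : IsUnit x := by
  obtain ⟨a, ha⟩ := h
  obtain ⟨b, hb⟩ := h'
  have h1 : x * (y * ↑a⁻¹) = 1 := by rw [← mul_assoc, ← ha, Units.mul_inv]
  have h2 : ↑b⁻¹ * y * x = 1 := by rw [mul_assoc, ← hb, Units.inv_mul]
  have h3 := left_inv_eq_right_inv h2 h1
  exact ⟨⟨x, _, h1, h3 ▸ h2⟩, rfl⟩

/-- The decomposition of the normalized units modulo a nil ideal `I(P)`, when `G / P` is a direct
product of a group `D` for which `F[D]` is a finite product of fields and a group `T` with the two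
unique products property. -/
theorem nonempty_quotient_mulEquiv {D : Type*} [Group D] [TwoUniqueProds T] {P : Subgroup G}
    [P.Normal] (hnil : ∀ x ∈ relAugIdeal F P, IsNilpotent x) (ρ : G →* D) (τ : G →* T)
    (hker : (τ.prod ρ).ker = P) (hsurj : Function.Surjective (τ.prod ρ)) {n : ℕ}
    (hn : IsDirectSumOfFields (MonoidAlgebra F D) n) :
    Nonempty ((normalizedUnits F G ⧸ onePlusIdeal F P) ≃* normalizedUnits F D × (Fin n → T)) := by
  obtain ⟨K, _, ⟨e⟩⟩ := hn
  let κ : ∀ i, MonoidAlgebra F D →+* K i := fun i ↦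
    (Pi.evalRingHom K i).comp (e : MonoidAlgebra F D →+* ∀ i, K i)
  have hκ : ∀ {x y : MonoidAlgebra F D}, (∀ i, κ i x = κ i y) → x = y := fun h ↦
    e.injective (funext h)
  let Φ : ∀ i, MonoidAlgebra F G →+* MonoidAlgebra (K i) T := fun i ↦ gradedHom ρ τ (κ i)
  have hΦker : ∀ x, (∀ i, Φ i x = 0) → x ∈ relAugIdeal F P := by
    intro x hx
    have h1 := eq_zero_of_mapRingHom_eq_zero e hx
    rw [← hker, mem_relAugIdeal_ker]
    exact (map_eq_zero_iff _ (curryRingEquiv : MonoidAlgebra F (T × D) ≃+* _).injective).1 h1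
  have hΦzero : ∀ x ∈ relAugIdeal F P, ∀ i, Φ i x = 0 := by
    intro x hx i
    rw [← hker, mem_relAugIdeal_ker] at hx
    simp [Φ, gradedHom, hx]
  have hΦsurj : ∀ w : ∀ i, MonoidAlgebra (K i) T, ∃ x, ∀ i, Φ i x = w i := by
    intro w
    obtain ⟨u, hu⟩ := exists_mapRingHom_eq e w
    obtain ⟨y, rfl⟩ := (curryRingEquiv : MonoidAlgebra F (T × D) ≃+* _).surjective u
    obtain ⟨x, rfl⟩ := mapDomainRingHom_surjective F hsurj y
    exact ⟨x, hu⟩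
  choose deg hdeg using fun i ↦ exists_unitDegree (K i) T
  let δ : normalizedUnits F G →* (Fin n → T) := MonoidHom.pi fun i ↦
    (deg i).comp ((Units.map (Φ i : MonoidAlgebra F G →* MonoidAlgebra (K i) T)).comp
      (normalizedUnits F G).subtype)
  have hδ : ∀ (v : normalizedUnits F G) i t r,
      Φ i ((v : (MonoidAlgebra F G)ˣ) : MonoidAlgebra F G) = single t r → δ v i = t :=
    fun v i t r h ↦ hdeg i _ t r h
  -- The image of `v` in `Kᵢ[T]` is a trivial unit; its scalar is its augmentation over `T`, which
  -- is the `i`-th component of the image of `v` in `FD`.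
  have hΦδ : ∀ (v : normalizedUnits F G) i,
      Φ i ((v : (MonoidAlgebra F G)ˣ) : MonoidAlgebra F G) = single (δ v i) (κ i
        ((normalizedUnitsMap F ρ v : (MonoidAlgebra F D)ˣ) : MonoidAlgebra F D)) := by
    intro v i
    obtain ⟨t, r, -, htr⟩ := exists_eq_single_of_mul_eq_one
      ((Units.map (Φ i : MonoidAlgebra F G →* MonoidAlgebra (K i) T)) v).mul_inv
    have htr' : Φ i ((v : (MonoidAlgebra F G)ˣ) : MonoidAlgebra F G) = single t r := htr
    have haug := augmentation_gradedHom ρ τ (κ i) ((v : (MonoidAlgebra F G)ˣ) : MonoidAlgebra F G)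
    rw [coe_normalizedUnitsMap, ← haug, hδ v i t r htr']
    change _ = single t (augmentation (K i) T (Φ i _))
    rw [htr', augmentation_single]
  let Ω : normalizedUnits F G →* normalizedUnits F D × (Fin n → T) :=
    (normalizedUnitsMap F ρ).prod δ
  have hΩker : Ω.ker = onePlusIdeal F P := by
    ext v
    rw [MonoidHom.mem_ker, mem_onePlusIdeal]
    constructor
    · intro hv
      refine hΦker _ fun i ↦ ?_
      have h1 : normalizedUnitsMap F ρ v = 1 := congrArg Prod.fst hv
      have h2 : δ v = 1 := congrArg Prod.snd hv
      have h3 : κ i (((1 : normalizedUnits F D) : (MonoidAlgebra F D)ˣ) : MonoidAlgebra F D) = 1 :=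
        map_one (κ i)
      rw [map_sub, map_one, hΦδ, h1, h2, h3, Pi.one_apply, ← one_def, sub_self]
    · intro hv
      refine Prod.ext (normalizedUnits_ext ?_) (funext fun i ↦ ?_)
      · refine hκ fun i ↦ ?_
        have h1 := augmentation_gradedHom ρ τ (κ i)
          (((v : (MonoidAlgebra F G)ˣ) : MonoidAlgebra F G) - 1)
        have h2 : gradedHom ρ τ (κ i) (((v : (MonoidAlgebra F G)ˣ) : MonoidAlgebra F G) - 1) = 0 :=
          hΦzero _ hv i
        rw [h2, map_zero, map_sub, map_sub, map_one, eq_comm, sub_eq_zero] at h1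
        exact h1
      · have h1 := hΦzero _ hv i
        rw [map_sub, map_one, sub_eq_zero] at h1
        exact hδ v i 1 1 h1
  have hΩsurj : Function.Surjective Ω := by
    rintro ⟨w, t⟩
    obtain ⟨x, hx⟩ := hΦsurj fun i ↦
      single (t i) (κ i ((w : (MonoidAlgebra F D)ˣ) : MonoidAlgebra F D))
    obtain ⟨y, hy⟩ := hΦsurj fun i ↦
      single (t i)⁻¹ (κ i (((w : (MonoidAlgebra F D)ˣ)⁻¹ : (MonoidAlgebra F D)ˣ) :
        MonoidAlgebra F D))
    -- Such a `z` differs from `1` by an element of the nil ideal; applied to `xy` and `yx`, this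
    -- makes the lift `x` a unit.
    have hunit : ∀ z, (∀ i, Φ i z = 1) → IsUnit z := by
      intro z hz
      have h1 := hnil (z - 1) (hΦker _ fun i ↦ by rw [map_sub, map_one, hz, sub_self])
      have h2 := h1.isUnit_one_add
      rwa [add_sub_cancel] at h2
    have hxu : IsUnit x := by
      refine isUnit_of_mul_isUnit (y := y) (hunit _ fun i ↦ ?_) (hunit _ fun i ↦ ?_)
      · rw [map_mul, hx, hy, single_mul_single, mul_inv_cancel, ← map_mul, Units.mul_inv, map_one,
          one_def]
      · rw [map_mul, hx, hy, single_mul_single, inv_mul_cancel, ← map_mul, Units.inv_mul, map_one,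
          one_def]
    have hxρ : mapDomainRingHom F ρ x = ((w : (MonoidAlgebra F D)ˣ) : MonoidAlgebra F D) := by
      refine hκ fun i ↦ ?_
      rw [← augmentation_gradedHom ρ τ (κ i) x]
      change augmentation (K i) T (Φ i x) = _
      rw [hx, augmentation_single]
    let v : normalizedUnits F G := ⟨hxu.unit, mem_normalizedUnits.2 (by
      rw [IsUnit.unit_spec, ← augmentation_mapDomain F ρ, hxρ]
      exact mem_normalizedUnits.1 w.2)⟩
    exact ⟨v, Prod.ext (normalizedUnits_ext hxρ) (funext fun i ↦ hδ v i _ _ (hx i))⟩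
  exact ⟨(QuotientGroup.quotientMulEquivOfEq hΩker.symm).trans
    (QuotientGroup.quotientKerEquivOfSurjective Ω hΩsurj)⟩

end QuotientEquiv

/-! ### The quotient by `1 + I(P)` for the subgroup of `p`-elements -/

section

variable {F G : Type*} [Field F] [Group G] {p : ℕ} [Fact p.Prime] [CharP F p]

theorem nonempty_quotient_pElements_mulEquiv [Group.IsNilpotent G] [Finite (commutator G)]
    (hp : IsPGroup p (commutator G)) (hk : ∃ k, ∀ a : G, a ^ p ^ k ∈ Subgroup.center G)
    [Finite (centralPrimeTo G p)] {n : ℕ}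
    (hn : IsDirectSumOfFields (MonoidAlgebra F (centralPrimeTo G p)) n) :
    Nonempty ((normalizedUnits F G ⧸ onePlusIdeal F (pElements p hp)) ≃*
      normalizedUnits F (centralPrimeTo G p) × (Fin n → G ⧸ torsionSubgroup G)) := by
  obtain ⟨ρ, hρ⟩ := exists_retraction_centralPrimeTo hp hk
  have hsup := pElements_sup_centralPrimeTo hp hk
  have hρP : ∀ x ∈ pElements p hp, ρ x = 1 := by
    rintro x ⟨k, hx⟩
    refine Subtype.ext (eq_one_of_mem_centralPrimeTo (ρ x).2 ⟨k, ?_⟩)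
    rw [← Subgroup.coe_pow, ← map_pow, hx, map_one, Subgroup.coe_one]
  refine nonempty_quotient_mulEquiv
    (fun x hx ↦ isNilpotent_of_mem_relAugIdeal (isPGroup_pElements hp) hx) ρ
    (QuotientGroup.mk' (torsionSubgroup G)) ?_ ?_ hn
  · ext g
    rw [MonoidHom.mem_ker, MonoidHom.prod_apply, Prod.mk_eq_one, QuotientGroup.mk'_apply,
      QuotientGroup.eq_one_iff]
    constructor
    · rintro ⟨hg, hρg⟩
      rw [← hsup] at hg
      obtain ⟨x, hx, d, hd, rfl⟩ := Subgroup.mem_sup_of_normal_left.1 hg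
      rw [map_mul, hρP x hx, one_mul, hρ ⟨d, hd⟩] at hρg
      have hd1 : d = 1 := congrArg Subtype.val hρg
      rwa [hd1, mul_one]
    · intro hg
      exact ⟨hsup ▸ Subgroup.mem_sup_left hg, hρP g hg⟩
  · rintro ⟨t, d⟩
    obtain ⟨g, rfl⟩ := QuotientGroup.mk_surjective t
    -- Correcting `g` by an element of `D` adjusts its image under `ρ` without changing its class
    -- modulo torsion.
    refine ⟨g * ((ρ g)⁻¹ * d : centralPrimeTo G p), Prod.ext ?_ ?_⟩
    · change ((g * ((ρ g)⁻¹ * d : centralPrimeTo G p) : G) : G ⧸ torsionSubgroup G) = g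
      rw [QuotientGroup.mk_mul, (QuotientGroup.eq_one_iff
        (((ρ g)⁻¹ * d : centralPrimeTo G p) : G)).2
        (hsup ▸ Subgroup.mem_sup_right (SetLike.coe_mem _)), mul_one]
    · change ρ (g * ((ρ g)⁻¹ * d : centralPrimeTo G p)) = d
      rw [map_mul, hρ, mul_inv_cancel_left]

end

end GroupAlgebraUnits

/-! ### The theorem -/

open GroupAlgebraUnits in
theorem corollary1 {F : Type*} {G : Type*} [Field F] [Group G] (p : ℕ) [Fact p.Prime] [CharP F p]
    (hmod : ∃ g : G, orderOf g = p) :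
    (Group.IsNilpotent (normalizedUnits F G) ↔
      Group.IsNilpotent G ∧ Finite (commutator G) ∧ IsPGroup p (commutator G)) ∧
    (Group.IsNilpotent (normalizedUnits F G) →
      -- `P` is the unique Sylow `p`-subgroup of `G`
      ∃ P : Sylow p G, (∀ Q : Sylow p G, Q = P) ∧
        -- `1 + I(P)` consists of normalized units and is the unique Sylow `p`-subgroup of `V(FG)`
        {x : MonoidAlgebra F G | ∃ v ∈ onePlusIdeal F (P : Subgroup G),
            x = ((v : (MonoidAlgebra F G)ˣ) : MonoidAlgebra F G)} =
          {x : MonoidAlgebra F G | ∃ y ∈ relAugIdeal F (P : Subgroup G), x = 1 + y} ∧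
        (∃ S : Sylow p (normalizedUnits F G),
          (S : Subgroup (normalizedUnits F G)) = onePlusIdeal F (P : Subgroup G) ∧
          ∀ T : Sylow p (normalizedUnits F G), T = S) ∧
        commutator (normalizedUnits F G) ≤ onePlusIdeal F (commutator G) ∧
        -- `t(G)` is the internal direct product of `P` and a central subgroup `D`
        (torsionSubgroup G : Set G) = torsionPart G ∧
        ∃ D : Subgroup G, D ≤ Subgroup.center G ∧ Disjoint (P : Subgroup G) D ∧
          (P : Subgroup G) ⊔ D = torsionSubgroup G ∧
          (Finite D →
            (∀ a b : normalizedUnits F G ⧸ onePlusIdeal F (P : Subgroup G), a * b = b * a) ∧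
            (∃ n : ℕ, IsDirectSumOfFields (MonoidAlgebra F D) n) ∧
            ∀ n : ℕ, IsDirectSumOfFields (MonoidAlgebra F D) n →
              Nonempty ((normalizedUnits F G ⧸ onePlusIdeal F (P : Subgroup G)) ≃*
                normalizedUnits F D × (Fin n → G ⧸ torsionSubgroup G)))) := by
  refine ⟨⟨fun hV ↦ ?_, ?_⟩, fun hV ↦ ?_⟩
  · exact ⟨isNilpotent_of_normalizedUnits F, (structure_of_isNilpotent_normalizedUnits F p hmod).2⟩
  · rintro ⟨hG, hfin, hp⟩
    obtain ⟨n, hn⟩ := exists_lieIdeal_eq_bot F p _ G hp rfl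
    exact isNilpotent_normalizedUnits_of_lieIdeal hn
  · have hG := isNilpotent_of_normalizedUnits F (G := G)
    obtain ⟨hk, hfin, hp⟩ := structure_of_isNilpotent_normalizedUnits F p hmod
    have hP := isPGroup_pElements hp
    refine ⟨sylowOfContains hP fun g hg ↦ hg, eq_sylowOfContains hP _,
      setOf_onePlusIdeal (P := pElements p hp) hP,
      ⟨sylowOfContains (isPGroup_onePlusIdeal (P := pElements p hp) hP)
        fun v hv ↦ mem_onePlusIdeal_pElements hp hv, rfl,
        eq_sylowOfContains _ _⟩, commutator_le_onePlusIdeal le_rfl, coe_torsionSubgroup,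
      centralPrimeTo G p, centralPrimeTo_le_center, disjoint_pElements_centralPrimeTo hp,
      pElements_sup_centralPrimeTo hp hk, fun hD ↦ ⟨?_, ?_, fun n hn ↦
        nonempty_quotient_pElements_mulEquiv hp hk hn⟩⟩
    · exact mul_comm_quotient (commutator_le_onePlusIdeal (commutator_le_pElements hp))
    · refine exists_isDirectSumOfFields (p := p) _ (fun a b ↦ Subtype.ext
        (Subgroup.mem_center_iff.1 (centralPrimeTo_le_center b.2) a)) fun a ha ↦ Subtype.ext
        (eq_one_of_mem_centralPrimeTo a.2 ⟨1, ?_⟩)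
      rw [pow_one]
      exact congrArg Subtype.val ha
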